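/- Let $d\ge 1$, let $(M_1,\mathfrak g)$ and $(M_2,\mathfrak h)$ be smooth, oriented $d$-dimensional Riemannian manifolds (Hausdorff, second countable, without boundary), and let $f:M_1\to M_2$ be of class $C^2$. *Intrinsic notions.* For a linear map $A:V\to W$ between oriented $d$-dimensional inner-product spaces let $\operatorname{Cof}A=(-1)^{d-1}\star_W^{d-1}\circ\Lambda^{d-1}A\circ\star_V^1$, with $\star$ the Hodge star on multivectors. Let $\nabla^{f^*TM_2}$ be the connection on $f^*TM_2$ induced by the Levi-Civita connection of $M_2$, and $\delta_{\nabla^{f^*TM_2}}$ its formal adjoint. For $U\subseteq M_1$ open, the Riemannian Piola identity on $U$ is $\delta_{\nabla^{f^*TM_2}}\operatorname{Cof}df=0$ on $U$, that is, $$\int_{M_1}\langle \operatorname{Cof}df,\nabla^{f^*TM_2}\xi\rangle_{\mathfrak g,\mathfrak h}\,d\mathrm{Vol}_1=0$$ for every $C^1$ section $\xi$ of $f^*TM_2$ with compact support in $U$. *Coordinates.* Let $x$ be a smooth chart of $M_1$ and $y$ a smooth chart of $M_2$, and let $U=\operatorname{dom}x\cap f^{-1}(\operatorname{dom}y)$.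 Write $f^\alpha$ for the components of $y\circ f\circ x^{-1}$ on $x(U)$, $[df]=(\partial_if^\alpha)$ for its Jacobian matrix, $\operatorname{cof}[df]$ for the matrix cofactor (the transpose of the adjugate), $|\mathfrak h|$ for the determinant of the matrix $(\mathfrak h_{\alpha\beta})$ of the metric of $M_2$ in the chart $y$, $\Gamma^\alpha_{\beta\gamma}$ for its Christoffel symbols, and $|f^*\mathfrak h|$, $f^*\Gamma^\alpha_{\beta\gamma}$ for the compositions of these functions with $y\circ f\circ x^{-1}$. Repeated indices are summed. 1. For all charts $x,y$, the Riemannian Piola identity on $U$ is equivalent to the validity on $x(U)$, for all $\gamma$, of $$-\frac1{|f^*\mathfrak h|^{1/2}}\,\partial_j\Big((\operatorname{cof}[df]^T)^j_\gamma\,|f^*\mathfrak h|^{1/2}\Big)+(f^*\Gamma^\beta_{\beta\gamma})\det[df]=0.\tag{A}$$ Moreover, if $x$ and $y$ are positively oriented, then for every $C^1$ section $\xi$ of $f^*TM_2$, with components $\xi^\gamma$, one has on $x(U)$ $$\langle \operatorname{Cof}df,\nabla^{f^*TM_2}\xi\rangle_{\mathfrak g,\mathfrak h}\,|\mathfrak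 g|^{1/2}=\Big((\operatorname{cof}[df]^T)^j_\gamma\,\partial_j\xi^\gamma+(f^*\Gamma^\beta_{\beta\gamma})\det[df]\,\xi^\gamma\Big)|f^*\mathfrak h|^{1/2}.$$ 2. At every point of $x(U)$ and for every $\gamma$, the left-hand side of (A) equals $-\partial_j\big((\operatorname{cof}[df]^T)^j_\gamma\big)$. Hence (A) is equivalent to the identity $$\partial_j\big((\operatorname{cof}[df]^T)^j_\gamma\big)=0,\tag{B}$$ which involves neither metric. Identity (B) holds on $x(U)$ for all charts $x,y$ and all $\gamma$, and the Riemannian Piola identity holds on all of $M_1$. 3. The formula $\partial_j\big(|f^*\mathfrak h|^{1/2}(\operatorname{cof}[df]^T)^j_\gamma\big)=0$ of Marsden and Hughes, which lacks the connection term, is incorrect: at every point of $x(U)$ its left-hand side equals $|f^*\mathfrak h|^{1/2}(f^*\Gamma^\beta_{\beta\gamma})\det[df]$, so for given $\gamma$ it vanishes at a point if and only if $f^*\Gamma^\beta_{\beta\gamma}=0$ or $\det[df]=0$ there. It fails even in the Euclidean setting: for every $d\ge1$ there are smooth charts $x,y$ of Euclidean $\mathbb R^d$ such that for $f=\mathrm{id}_{\mathbb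 R^d}$ the formula is violated at some point of $x(U)$ for some $\gamma$. -/

import Mathlib

open Bundle
open scoped Manifold ContDiff Matrix

noncomputable section

namespace Piola

/-! ### Multilinear algebra: Hodge star and intrinsic cofactor -/

section LinearAlgebra

variable {V W : Type*} [NormedAddCommGroup V] [InnerProductSpace ℝ V] [FiniteDimensional ℝ V]
  [NormedAddCommGroup W] [InnerProductSpace ℝ W] [FiniteDimensional ℝ W]

/-- The wedge product with a fixed right factor, `a ↦ a ∧ b`, as a map `⋀ᵏ V → ⋀ᵈ V`, where
`b : ⋀ˡ V` and `k + l = d`. -/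
def wedgeRight {k l d : ℕ} (h : k + l = d) (b : ⋀[ℝ]^l V) : ⋀[ℝ]^k V →ₗ[ℝ] ⋀[ℝ]^d V where
  toFun a := ⟨(a : ExteriorAlgebra ℝ V) * (b : ExteriorAlgebra ℝ V), by
    subst h
    exact SetLike.GradedMul.mul_mem a.2 b.2⟩
  map_add' a a' := by
    ext
    simp [add_mul]
  map_smul' c a := by
    ext
    simp

/-- The unit volume form of an oriented inner product space, as a linear functional on the top
exterior power: it takes the value `1` on `e₁ ∧ ⋯ ∧ e_d` for every positively oriented orthonormal
basis `e`. -/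
def volTop {d : ℕ} [Fact (Module.finrank ℝ V = d)] (o : Orientation ℝ V (Fin d)) :
    ⋀[ℝ]^d V →ₗ[ℝ] ℝ :=
  exteriorPower.alternatingMapLinearEquiv o.volumeForm

/-- The Hodge star `⋆ : ⋀ᵏ V → ⋀ˡ V`, `k + l = d`, of an oriented `d`-dimensional inner product
space. It is the map with `⟪⋆a, b⟫ = Vol (a ∧ b)` for all `b : ⋀ˡ V`, written out in the
orthonormal basis `e_T = e_{t₁} ∧ ⋯ ∧ e_{t_l}` of `⋀ˡ V` given by an orthonormal basis `e` of `V`;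
so `⋆ (e₁ ∧ ⋯ ∧ e_k) = e_{k+1} ∧ ⋯ ∧ e_d` for positively oriented orthonormal `e`. -/
def hodge {d k l : ℕ} [Fact (Module.finrank ℝ V = d)] (o : Orientation ℝ V (Fin d))
    (h : k + l = d) : ⋀[ℝ]^k V →ₗ[ℝ] ⋀[ℝ]^l V :=
  let e := (stdOrthonormalBasis ℝ V).toBasis.exteriorPower l
  ∑ T, (volTop o ∘ₗ wedgeRight h (e T)).smulRight (e T)

/-- The intrinsic cofactor `Cof A = (-1)^(d-1) ⋆_W^(d-1) ∘ ⋀^(d-1) A ∘ ⋆_V^1` of a linear map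
between oriented `d`-dimensional inner product spaces, with `⋀¹ V ≃ V` and `⋀¹ W ≃ W`. -/
def Cof {d : ℕ} [NeZero d] [Fact (Module.finrank ℝ V = d)] [Fact (Module.finrank ℝ W = d)]
    (oV : Orientation ℝ V (Fin d)) (oW : Orientation ℝ W (Fin d)) (A : V →ₗ[ℝ] W) :
    V →ₗ[ℝ] W :=
  (-1 : ℝ) ^ (d - 1) •
    ((exteriorPower.oneEquiv ℝ W).toLinearMap ∘ₗ
      hodge oW (Nat.sub_add_cancel (NeZero.one_le : 1 ≤ d)) ∘ₗ
      exteriorPower.map (d - 1) A ∘ₗ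
      hodge oV (Nat.add_sub_cancel' (NeZero.one_le : 1 ≤ d)) ∘ₗ
      (exteriorPower.oneEquiv ℝ V).symm.toLinearMap)

/-- The inner product on `Hom(V, W) = V* ⊗ W` induced by those of `V` and `W`:
`⟪A, B⟫ = tr (Aᵀ B) = ∑ i, ⟪A eᵢ, B eᵢ⟫` for any orthonormal basis `e` of `V`. -/
def homInner (A B : V →ₗ[ℝ] W) : ℝ :=
  LinearMap.trace ℝ V (LinearMap.adjoint A ∘ₗ B)

/-- The cofactor of a matrix, the transpose of its adjugate. -/
def matCof {d : ℕ} (A : Matrix (Fin d) (Fin d) ℝ) : Matrix (Fin d) (Fin d) ℝ :=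
  A.adjugateᵀ

end LinearAlgebra

/-! ### Coordinates on a Riemannian manifold -/

/-- Coordinate space `ℝᵈ`. -/
abbrev Coord (d : ℕ) : Type := EuclideanSpace ℝ (Fin d)

/-- The `i`-th standard basis vector of `ℝᵈ`. -/
def stdVec {d : ℕ} (i : Fin d) : Coord d := EuclideanSpace.single i 1

/-- The partial derivative `∂ᵢ φ` of a function of `d` real variables. -/
def pd {d : ℕ} (i : Fin d) (φ : Coord d → ℝ) (u : Coord d) : ℝ := fderiv ℝ φ u (stdVec i)

section Manifold

variable {d : ℕ} {M : Type*} [TopologicalSpace M] [ChartedSpace (Coord d) M]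

instance (p : M) : FiniteDimensional ℝ (TangentSpace (𝓡 d) p) :=
  inferInstanceAs (FiniteDimensional ℝ (Coord d))

instance (p : M) : Fact (Module.finrank ℝ (TangentSpace (𝓡 d) p) = d) :=
  ⟨(finrank_euclideanSpace_fin : Module.finrank ℝ (Coord d) = d)⟩

/-- The coordinate components `v^α = dy^α(v)` of a tangent vector `v` at `q`. -/
def comp (y : OpenPartialHomeomorph M (Coord d)) (q : M) (α : Fin d) :
    TangentSpace (𝓡 d) q →ₗ[ℝ] ℝ :=
  (EuclideanSpace.proj (𝕜 := ℝ) α : Coord d →L[ℝ] ℝ).toLinearMap ∘ₗ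
    (mfderiv (𝓡 d) (𝓡 d) y q).toLinearMap

/-- The coordinate vector `∂_α` at the point `q` of the domain of the chart `y`, i.e. the tangent
vector that `dy` maps to the `α`-th standard basis vector. -/
def frame (y : OpenPartialHomeomorph M (Coord d)) (q : M) (α : Fin d) :
    TangentSpace (𝓡 d) q :=
  (mfderiv (𝓡 d) (𝓡 d) y q).inverse (stdVec α)

variable [RiemannianBundle (fun p : M => TangentSpace (𝓡 d) p)]

/-- The matrix `h_{αβ} = ⟪∂_α, ∂_β⟫` of the metric in the chart `y`, as a function of the
coordinates. -/
def gram (y : OpenPartialHomeomorph M (Coord d)) (v : Coord d) : Matrix (Fin d) (Fin d) ℝ :=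
  Matrix.of fun α β => inner ℝ (frame y (y.symm v) α) (frame y (y.symm v) β)

/-- The volume density `|h|^{1/2}` in the chart `y`. -/
def density (y : OpenPartialHomeomorph M (Coord d)) (v : Coord d) : ℝ :=
  √(gram y v).det

/-- The Christoffel symbols `Γ^α_{βγ}` of the Levi-Civita connection in the chart `y`:
`Γ^α_{βγ} = ½ h^{αδ} (∂_β h_{δγ} + ∂_γ h_{δβ} - ∂_δ h_{βγ})`. -/
def christoffel (y : OpenPartialHomeomorph M (Coord d)) (α β γ : Fin d) (v : Coord d) : ℝ :=
  (1 / 2) * ∑ δ, (gram y v)⁻¹ α δ *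
    (pd β (fun w => gram y w δ γ) v + pd γ (fun w => gram y w δ β) v
      - pd δ (fun w => gram y w β γ) v)

/-- The measure `|g|^{1/2} dx` on the domain of the chart `x`. -/
def chartVolume [MeasurableSpace M] (x : OpenPartialHomeomorph M (Coord d)) :
    MeasureTheory.Measure M :=
  (((MeasureTheory.volume : MeasureTheory.Measure (Coord d)).restrict x.target).withDensity
    fun u => ENNReal.ofReal (density x u)).map x.symm

variable (d M) in
/-- The Riemannian volume measure `dVol`: the smallest measure that dominates `|g|^{1/2} dx` on the
domain of every chart (on each such domain it coincides with it, since these measures agree on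
overlaps). -/
def riemVolume [MeasurableSpace M] : MeasureTheory.Measure M :=
  ⨆ x ∈ IsManifold.maximalAtlas (𝓡 d) ∞ M, chartVolume x

/-- The chart `x` is positively oriented for the family `o` of orientations of the tangent spaces:
the coordinate frame is positively oriented at each point of the domain. -/
def IsPositiveChart (o : ∀ p : M, Orientation ℝ (TangentSpace (𝓡 d) p) (Fin d))
    (x : OpenPartialHomeomorph M (Coord d)) : Prop :=
  ∀ p ∈ x.source, 0 < (o p).volumeForm (frame x p)

variable (d M) in
/-- An orientation of a manifold: orientations of the tangent spaces, such that there is a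
positively oriented smooth chart around each point. -/
structure ManifoldOrientation where
  /-- the orientation of the tangent space at `p` -/
  orient : ∀ p : M, Orientation ℝ (TangentSpace (𝓡 d) p) (Fin d)
  exists_positive : ∀ p : M, ∃ x ∈ IsManifold.maximalAtlas (𝓡 d) ∞ M,
    p ∈ x.source ∧ IsPositiveChart orient x

end Manifold

/-! ### The Riemannian Piola identity -/

section Maps

variable {d : ℕ} {M₁ M₂ : Type*}
  [TopologicalSpace M₁] [ChartedSpace (Coord d) M₁]
  [TopologicalSpace M₂] [ChartedSpace (Coord d) M₂]
  [RiemannianBundle (fun p : M₂ => TangentSpace (𝓡 d) p)]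

/-- The covariant derivative `∇^{f^*TM₂} ξ` at `p` of a vector field `ξ` along `f`, computed in
the chart `y` of `M₂` around `f p`: its `β`-component is `dξ^β + Γ^β_{γδ}(f) df^γ ξ^δ`. -/
def covDerivIn (y : OpenPartialHomeomorph M₂ (Coord d)) (f : M₁ → M₂)
    (ξ : ∀ p, TangentSpace (𝓡 d) (f p)) (p : M₁) :
    TangentSpace (𝓡 d) p →ₗ[ℝ] TangentSpace (𝓡 d) (f p) :=
  ∑ β, ((mvfderiv (𝓡 d) (fun q => comp y (f q) β (ξ q)) p).toLinearMap +
    ∑ γ, ∑ δ, (christoffel y β γ δ (y (f p)) * comp y (f p) δ (ξ p)) •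
      (comp y (f p) γ ∘ₗ (mfderiv (𝓡 d) (𝓡 d) f p).toLinearMap)).smulRight (frame y (f p) β)

/-- The covariant derivative `∇^{f^*TM₂} ξ` induced by the Levi-Civita connection of `M₂` on vector
fields along `f` (the value does not depend on the chart of `M₂` around `f p`). -/
def covDeriv (f : M₁ → M₂) (ξ : ∀ p, TangentSpace (𝓡 d) (f p)) (p : M₁) :
    TangentSpace (𝓡 d) p →ₗ[ℝ] TangentSpace (𝓡 d) (f p) :=
  covDerivIn (chartAt (Coord d) (f p)) f ξ p

/-- `ξ` is a `C¹` section of `f^*TM₂`. -/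
def IsC1Along [IsManifold (𝓡 d) ∞ M₂] (f : M₁ → M₂) (ξ : ∀ p, TangentSpace (𝓡 d) (f p)) : Prop :=
  ContMDiff (𝓡 d) (𝓡 d).tangent 1 (fun p => (⟨f p, ξ p⟩ : TangentBundle (𝓡 d) M₂))

variable [RiemannianBundle (fun p : M₁ => TangentSpace (𝓡 d) p)]

/-- `Cof df`, a one-form on `M₁` with values in `f^*TM₂`. -/
def cofDiff [NeZero d] (o₁ : ManifoldOrientation d M₁) (o₂ : ManifoldOrientation d M₂)
    (f : M₁ → M₂) (p : M₁) : TangentSpace (𝓡 d) p →ₗ[ℝ] TangentSpace (𝓡 d) (f p) :=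
  Cof (o₁.orient p) (o₂.orient (f p)) (mfderiv (𝓡 d) (𝓡 d) f p).toLinearMap

/-- `η = δ_{∇^{f^*TM₂}} ρ` on the open set `U`: the section `η` is the image of the
`f^*TM₂`-valued one-form `ρ` under the formal adjoint of `∇^{f^*TM₂}`, i.e.
`∫ ⟪σ, η⟫ dVol = ∫ ⟪∇σ, ρ⟫ dVol` for all sections `σ` with compact support in `U`. -/
def IsCoderivativeOn [IsManifold (𝓡 d) ∞ M₂] [MeasurableSpace M₁] (f : M₁ → M₂) (U : Set M₁)
    (ρ : ∀ p, TangentSpace (𝓡 d) p →ₗ[ℝ] TangentSpace (𝓡 d) (f p))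
    (η : ∀ p, TangentSpace (𝓡 d) (f p)) : Prop :=
  ∀ σ : ∀ p, TangentSpace (𝓡 d) (f p), IsC1Along f σ →
    IsCompact (closure {p | σ p ≠ 0}) → closure {p | σ p ≠ 0} ⊆ U →
    ∫ p, inner ℝ (σ p) (η p) ∂(riemVolume d M₁) =
      ∫ p, homInner (covDeriv f σ p) (ρ p) ∂(riemVolume d M₁)

/-- The Riemannian Piola identity `δ_{∇^{f^*TM₂}} Cof df = 0` on the open set `U`. -/
def RiemannianPiolaOn [NeZero d] [IsManifold (𝓡 d) ∞ M₂] [MeasurableSpace M₁]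
    (o₁ : ManifoldOrientation d M₁) (o₂ : ManifoldOrientation d M₂)
    (f : M₁ → M₂) (U : Set M₁) : Prop :=
  IsCoderivativeOn f U (cofDiff o₁ o₂ f) (fun _ => 0)

end Maps

/-! ### Coordinate expressions -/

section Coordinates

variable {d : ℕ} {M₁ M₂ : Type*}
  [TopologicalSpace M₁] [ChartedSpace (Coord d) M₁]
  [TopologicalSpace M₂] [ChartedSpace (Coord d) M₂]

/-- The coordinate representation of `f` in the charts `x` and `y`. -/
def coordRep (f : M₁ → M₂) (x : OpenPartialHomeomorph M₁ (Coord d))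
    (y : OpenPartialHomeomorph M₂ (Coord d)) (u : Coord d) : Coord d :=
  y (f (x.symm u))

/-- The set of coordinates in which the representation of `f` in the charts `x`, `y` is defined. -/
def coordDomain (f : M₁ → M₂) (x : OpenPartialHomeomorph M₁ (Coord d))
    (y : OpenPartialHomeomorph M₂ (Coord d)) : Set (Coord d) :=
  {u | u ∈ x.target ∧ f (x.symm u) ∈ y.source}

/-- The matrix `[df]` with entries `∂ᵢ f^α` (row `α`, column `i`). -/
def jac (f : M₁ → M₂) (x : OpenPartialHomeomorph M₁ (Coord d))
    (y : OpenPartialHomeomorph M₂ (Coord d)) (u : Coord d) : Matrix (Fin d) (Fin d) ℝ :=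
  Matrix.of fun α i => pd i (fun w => coordRep f x y w α) u

/-- The expression `∂_j ((cof [df]ᵀ)^j_γ)`. -/
def divCof (f : M₁ → M₂) (x : OpenPartialHomeomorph M₁ (Coord d))
    (y : OpenPartialHomeomorph M₂ (Coord d)) (γ : Fin d) (u : Coord d) : ℝ :=
  ∑ j, pd j (fun w => (matCof (jac f x y w))ᵀ j γ) u

variable [RiemannianBundle (fun p : M₂ => TangentSpace (𝓡 d) p)]

/-- The function `|f^*h|^{1/2}`, i.e. `|h|^{1/2}` composed with the representation of `f`. -/
def pullDensity (f : M₁ → M₂) (x : OpenPartialHomeomorph M₁ (Coord d))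
    (y : OpenPartialHomeomorph M₂ (Coord d)) (u : Coord d) : ℝ :=
  density y (coordRep f x y u)

/-- The function `f^*Γ^β_{βγ}` (summed over `β`). -/
def pullTraceChristoffel (f : M₁ → M₂) (x : OpenPartialHomeomorph M₁ (Coord d))
    (y : OpenPartialHomeomorph M₂ (Coord d)) (γ : Fin d) (u : Coord d) : ℝ :=
  ∑ β, christoffel y β β γ (coordRep f x y u)

/-- The expression `∂_j (|f^*h|^{1/2} (cof [df]ᵀ)^j_γ)`. -/
def divDensityCof (f : M₁ → M₂) (x : OpenPartialHomeomorph M₁ (Coord d))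
    (y : OpenPartialHomeomorph M₂ (Coord d)) (γ : Fin d) (u : Coord d) : ℝ :=
  ∑ j, pd j (fun w => (matCof (jac f x y w))ᵀ j γ * pullDensity f x y w) u

/-- The expression
`- |f^*h|^{-1/2} ∂_j ((cof [df]ᵀ)^j_γ |f^*h|^{1/2}) + (f^*Γ^β_{βγ}) det [df]`. -/
def coordPiola (f : M₁ → M₂) (x : OpenPartialHomeomorph M₁ (Coord d))
    (y : OpenPartialHomeomorph M₂ (Coord d)) (γ : Fin d) (u : Coord d) : ℝ :=
  -(1 / pullDensity f x y u) * divDensityCof f x y γ u +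
    pullTraceChristoffel f x y γ u * (jac f x y u).det

end Coordinates

end Piola

end

open Piola

/-! Everything rests on the classical Piola identity `sum_pd_adjugate_jacobian`. The entry `(adj J)
j γ` is the determinant of `J` with row `γ` replaced by `e_j`. Applying `∂_j` and summing over `j`
gives, for each `α ≠ γ`, second derivatives `∂_j ∂_i F^α`, symmetric in `i, j`, paired with
determinants in which `e_j` and `e_i` fill rows `γ` and `α`, antisymmetric in `i, j`. Hence the sum
vanishes.

The metric of the target enters only through `∂_γ |h|^{1/2} = |h|^{1/2} Γ^β_{βγ}` (`pd_density`,
from Jacobi's formula). By the chain rule and `J * adj J = det J`, differentiating `|f^*h|^{1/2}` in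
the divergence yields precisely the connection term with `det [df]` (`divDensityCof_eq_add`). This
term cancels in the coordinate form of the Riemannian identity and is exactly the error in the
formula without it.

For the weak form, `homInner_Cof_mul_volumeForm` expresses `⟪Cof A, B⟫` in arbitrary bases as `tr
(adj [A] [B])` times a ratio of volume forms. In positive charts the integrand times `|g|^{1/2}` is
therefore the divergence of a flux with components `(adj [df])^j_γ |f^*h|^{1/2} ξ^γ`
(`homInner_cofDiff_covDeriv_eq_div`), so its integral vanishes when `ξ` has compact support in the
chart domain. A partition of unity on the support gives the identity on all of `M₁`. Two invariance
facts are needed on the way: the pulled-back covariant derivative does not depend on the chart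
(`covDerivIn_eq_covDerivIn`), and the supremum of the chart measures restricts to `|g|^{1/2} dx` on
every chart domain (`riemVolume_restrict_source`).

The Euclidean counterexample is the identity map in a chart that stretches one axis non-uniformly.
-/

noncomputable section

namespace Piola

/-! ### Hodge star and the intrinsic cofactor in terms of determinants. -/

section LinearAlgebra

set_option linter.unusedSectionVars false

variable {V W : Type*} [NormedAddCommGroup V] [InnerProductSpace ℝ V] [FiniteDimensional ℝ V]
  [NormedAddCommGroup W] [InnerProductSpace ℝ W] [FiniteDimensional ℝ W]

theorem volTop_ιMulti {d : ℕ} [Fact (Module.finrank ℝ V = d)] (o : Orientation ℝ V (Fin d))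
    (v : Fin d → V) : volTop o (exteriorPower.ιMulti ℝ d v) = o.volumeForm v := by
  simp [volTop]

/-- `hodge` sums over a basis indexed by `Fin (finrank ℝ V)`; this moves the sum to `Fin d`. -/
theorem sum_basis_exteriorPower_reindex {E : Type*} [AddCommMonoid E] {m d : ℕ} (h : m = d) (l : ℕ)
    (b : Module.Basis (Fin m) ℝ V) (G : ⋀[ℝ]^l V → E) :
    ∑ T, G (b.exteriorPower l T) = ∑ T, G ((b.reindex (finCongr h)).exteriorPower l T) := by
  subst h
  simp

theorem sum_basis_exteriorPower_one {E : Type*} [AddCommMonoid E] {d : ℕ}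
    (b : Module.Basis (Fin d) ℝ V) (G : ⋀[ℝ]^1 V → E) :
    ∑ T, G (b.exteriorPower 1 T) = ∑ i, G (exteriorPower.ιMulti ℝ 1 fun _ => b i) := by
  rw [← (Set.powersetCard.ofSingleton (α := Fin d)).sum_comp]
  refine Finset.sum_congr rfl fun i _ => ?_
  rw [exteriorPower.basis_apply, exteriorPower.ιMulti_family]
  congr 2
  funext j
  have h : Set.powersetCard.ofFinEmbEquiv.symm (Set.powersetCard.ofSingleton i) j ∈
      Set.range (Set.powersetCard.ofFinEmbEquiv.symm (Set.powersetCard.ofSingleton i)) := ⟨j, rfl⟩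
  rw [Set.powersetCard.mem_range_ofFinEmbEquiv_symm_iff_mem] at h
  have h' : Set.powersetCard.ofFinEmbEquiv.symm (Set.powersetCard.ofSingleton i) j = i := by
    simpa [Set.powersetCard.ofSingleton, ← Set.powersetCard.mem_coe_iff] using h
  simp [h']

/-- The `n`-element subsets of `Fin (n + 1)` are the complements of points, so a sum over them
becomes a sum over the omitted index. -/
theorem sum_basis_exteriorPower_compl {E : Type*} [AddCommMonoid E] {n : ℕ}
    (b : Module.Basis (Fin (n + 1)) ℝ V) (G : ⋀[ℝ]^n V → E) :
    ∑ T, G (b.exteriorPower n T) =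
      ∑ i : Fin (n + 1), G (exteriorPower.ιMulti ℝ n (b ∘ i.succAbove)) := by
  rw [← ((Set.powersetCard.ofSingleton (α := Fin (n + 1))).trans
    (Set.powersetCard.compl (m := n) (by simp))).sum_comp]
  refine Finset.sum_congr rfl fun i _ => ?_
  rw [exteriorPower.basis_apply, exteriorPower.ιMulti_family]
  congr 3
  rw [Set.powersetCard.ofFinEmbEquiv_symm_apply]
  exact congrArg DFunLike.coe (Finset.orderEmbOfFin_compl_singleton_eq_succAboveOrderEmb i)

/-- The standard orthonormal basis, indexed by `Fin d`. -/
def stdONB (V : Type*) [NormedAddCommGroup V] [InnerProductSpace ℝ V] [FiniteDimensional ℝ V]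
    {d : ℕ} [h : Fact (Module.finrank ℝ V = d)] : OrthonormalBasis (Fin d) ℝ V :=
  (stdOrthonormalBasis ℝ V).reindex (finCongr h.out)

theorem hodge_apply {d k l : ℕ} [Fact (Module.finrank ℝ V = d)] (o : Orientation ℝ V (Fin d))
    (h : k + l = d) (a : ⋀[ℝ]^k V) :
    hodge o h a = ∑ T, volTop o (wedgeRight h ((stdONB V (d := d)).toBasis.exteriorPower l T) a) •
      (stdONB V (d := d)).toBasis.exteriorPower l T := by
  have := sum_basis_exteriorPower_reindex (Fact.out : Module.finrank ℝ V = d) l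
    (stdOrthonormalBasis ℝ V).toBasis (fun b => volTop o (wedgeRight h b a) • b)
  simpa [hodge, stdONB, ← OrthonormalBasis.reindex_toBasis] using this

theorem wedgeRight_ιMulti {k l d : ℕ} (h : k + l = d) (a : Fin k → V) (b : Fin l → V) :
    wedgeRight h (exteriorPower.ιMulti ℝ l b) (exteriorPower.ιMulti ℝ k a) =
      exteriorPower.ιMulti ℝ d (Fin.append a b ∘ Fin.cast h.symm) := by
  subst h
  ext
  simp [wedgeRight, ExteriorAlgebra.ιMulti_mul_ιMulti]

/-- The defining property `⟪⋆a, w⟫ = Vol (a ∧ w)`, recovered from the formula in an orthonormal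
basis by expanding `w`. -/
theorem oneEquiv_hodge_inner {n : ℕ} [Fact (Module.finrank ℝ V = n + 1)]
    (o : Orientation ℝ V (Fin (n + 1))) (h : n + 1 = n + 1) (a : Fin n → V) (w : V) :
    inner ℝ (exteriorPower.oneEquiv ℝ V (hodge o h (exteriorPower.ιMulti ℝ n a))) w =
      o.volumeForm (Fin.snoc a w) := by
  have key (z : V) : volTop o (wedgeRight h (exteriorPower.ιMulti ℝ 1 fun _ => z)
      (exteriorPower.ιMulti ℝ n a)) = o.volumeForm (Fin.snoc a z) := by
    rw [wedgeRight_ιMulti, volTop_ιMulti]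
    congr 1
    rw [Fin.append_right_eq_snoc]
    rfl
  rw [hodge_apply, sum_basis_exteriorPower_one (stdONB V (d := n + 1)).toBasis
    (fun b => volTop o (wedgeRight h b (exteriorPower.ιMulti ℝ n a)) • b)]
  simp only [map_sum, map_smul, exteriorPower.oneEquiv_ιMulti, key, sum_inner,
    real_inner_smul_left, OrthonormalBasis.coe_toBasis]
  conv_rhs => rw [← (stdONB V (d := n + 1)).sum_repr w]
  set L := o.volumeForm.toMultilinearMap.toLinearMap
    (Fin.snoc a (0 : V) : Fin (n + 1) → V) (Fin.last n) with hL
  have hu (z : V) : o.volumeForm (Fin.snoc a z) = L z := by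
    rw [hL, MultilinearMap.toLinearMap_apply, Fin.update_snoc_last]
    rfl
  simp only [hu, map_sum, map_smul, smul_eq_mul, OrthonormalBasis.repr_apply_apply]
  exact Finset.sum_congr rfl fun _ _ => mul_comm _ _

theorem alternatingMap_vecCons_succAbove {n : ℕ} {E : Type*} [AddCommGroup E] [Module ℝ E]
    (f : E [⋀^Fin (n + 1)]→ₗ[ℝ] ℝ) (i : Fin (n + 1)) (v : Fin (n + 1) → E) (x : E) :
    f (Matrix.vecCons x (v ∘ i.succAbove)) = (-1) ^ (i : ℕ) * f (Function.update v i x) := by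
  have h : Fin.insertNth i x (v ∘ i.succAbove) = Function.update v i x :=
    Fin.insertNth_removeNth (α := fun _ => E) i x v
  rw [← f.neg_one_pow_smul_map_insertNth i, h]
  simp [zsmul_eq_mul]

theorem alternatingMap_snoc_succAbove {n : ℕ} {E : Type*} [AddCommGroup E] [Module ℝ E]
    (f : E [⋀^Fin (n + 1)]→ₗ[ℝ] ℝ) (i : Fin (n + 1)) (v : Fin (n + 1) → E) (x : E) :
    f (Fin.snoc (v ∘ i.succAbove) x) = (-1) ^ n * (-1) ^ (i : ℕ) * f (Function.update v i x) := by
  rw [mul_assoc, ← alternatingMap_vecCons_succAbove]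
  have := f.map_insertNth (Fin.last n) x (v ∘ i.succAbove)
  simpa [Fin.insertNth_last'] using this

theorem homInner_eq_sum {d : ℕ} (e : OrthonormalBasis (Fin d) ℝ V) (A B : V →ₗ[ℝ] W) :
    homInner A B = ∑ i, inner ℝ (A (e i)) (B (e i)) := by
  rw [homInner, LinearMap.trace_eq_sum_inner _ e]
  simp [LinearMap.adjoint_inner_right]

theorem homInner_comm (A B : V →ₗ[ℝ] W) : homInner A B = homInner B A := by
  simp only [homInner_eq_sum (stdOrthonormalBasis ℝ V), real_inner_comm]

theorem Cof_apply {n : ℕ} [NeZero (n + 1)] [Fact (Module.finrank ℝ V = n + 1)]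
    [Fact (Module.finrank ℝ W = n + 1)] (oV : Orientation ℝ V (Fin (n + 1)))
    (oW : Orientation ℝ W (Fin (n + 1))) (A : V →ₗ[ℝ] W) (v : V) :
    Cof oV oW A v = (-1 : ℝ) ^ n • exteriorPower.oneEquiv ℝ W (hodge oW rfl
      (exteriorPower.map n A (hodge oV (add_comm 1 n) ((exteriorPower.oneEquiv ℝ V).symm v)))) :=
  rfl

/-- The sum is the derivative of `Vol_W (A e₁, …, A e_d)` in the direction `B`: the cofactor is the
gradient of the determinant. The factor `oV.volumeForm (stdONB V)` is `±1`, because the standard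
orthonormal basis need not be positively oriented. -/
theorem homInner_Cof {d : ℕ} [NeZero d] [Fact (Module.finrank ℝ V = d)]
    [Fact (Module.finrank ℝ W = d)] (oV : Orientation ℝ V (Fin d)) (oW : Orientation ℝ W (Fin d))
    (A B : V →ₗ[ℝ] W) :
    homInner (Cof oV oW A) B = oV.volumeForm (stdONB V) *
      ∑ i, oW.volumeForm (Function.update (A ∘ stdONB V) i (B (stdONB V i))) := by
  obtain ⟨n, rfl⟩ : ∃ n, d = n + 1 := ⟨d - 1, (Nat.sub_add_cancel NeZero.one_le).symm⟩
  set e := stdONB V (d := n + 1) with he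
  rw [homInner_eq_sum e, Finset.mul_sum]
  refine Finset.sum_congr rfl fun i _ => ?_
  -- In `⋆ e_i` only the wedge omitting `e_i` survives: every other one repeats `e_i`.
  have key (j : Fin (n + 1)) (h : 1 + n = n + 1) :
      volTop oV (wedgeRight h (exteriorPower.ιMulti ℝ n (e ∘ j.succAbove))
        ((exteriorPower.oneEquiv ℝ V).symm (e i))) =
      if j = i then (-1) ^ (i : ℕ) * oV.volumeForm e else 0 := by
    rw [exteriorPower.oneEquiv_symm_apply]
    change volTop oV (wedgeRight h _ (exteriorPower.ιMulti ℝ 1 fun _ => e i)) = _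
    rw [wedgeRight_ιMulti, volTop_ιMulti, Fin.append_left_eq_cons]
    have : Fin.cons (e i) (e ∘ j.succAbove) ∘ Fin.cast (add_comm 1 n) ∘ Fin.cast h.symm =
      Matrix.vecCons (e i) (e ∘ j.succAbove) := rfl
    rw [Function.comp_assoc, this, alternatingMap_vecCons_succAbove]
    split_ifs with hj
    · subst hj; simp
    · rw [oV.volumeForm.map_eq_zero_of_eq _ (i := j) (j := i)
        (by simp [Function.update_of_ne (Ne.symm hj)]) hj, mul_zero]
  rw [Cof_apply, hodge_apply oV, ← he, sum_basis_exteriorPower_compl e.toBasis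
    (fun b => volTop oV (wedgeRight (add_comm 1 n) b
        ((exteriorPower.oneEquiv ℝ V).symm (e i))) • b)]
  simp only [OrthonormalBasis.coe_toBasis, key, ite_smul, zero_smul, Finset.sum_ite_eq',
    Finset.mem_univ, if_true, map_smul, exteriorPower.map_apply_ιMulti, real_inner_smul_left,
    oneEquiv_hodge_inner]
  rw [← Function.comp_assoc, alternatingMap_snoc_succAbove]
  -- The prefactor `(-1)^(d-1)` cancels the sign of moving the last slot to the front; the two signs
  -- `(-1)^i` cancel each other.
  have h1 : ((-1 : ℝ) ^ n) * (-1) ^ n = 1 := by rw [← mul_pow]; simp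
  have h2 : ((-1 : ℝ) ^ (i : ℕ)) * (-1) ^ (i : ℕ) = 1 := by rw [← mul_pow]; simp
  linear_combination (oV.volumeForm e * oW.volumeForm (Function.update (A ∘ e) i (B (e i)))) *
    ((-1 : ℝ) ^ (i : ℕ) * (-1) ^ (i : ℕ) * h1 + h2)

/-- Cramer's rule, one column at a time. -/
theorem sum_det_updateCol {d : ℕ} (M N : Matrix (Fin d) (Fin d) ℝ) :
    ∑ i, (M.updateCol i (fun k => N k i)).det = (M.adjugate * N).trace := by
  refine Finset.sum_congr rfl fun i _ => ?_
  rw [← Matrix.cramer_apply, Matrix.cramer_eq_adjugate_mulVec]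
  rfl

/-- The inner product of the cofactor of `A` with `B` in terms of arbitrary bases. -/
theorem homInner_Cof_mul_volumeForm {d : ℕ} [NeZero d] [Fact (Module.finrank ℝ V = d)]
    [Fact (Module.finrank ℝ W = d)] (oV : Orientation ℝ V (Fin d)) (oW : Orientation ℝ W (Fin d))
    (bV : Module.Basis (Fin d) ℝ V) (bW : Module.Basis (Fin d) ℝ W) (A B : V →ₗ[ℝ] W) :
    homInner (Cof oV oW A) B * oV.volumeForm bV =
      ((LinearMap.toMatrix bV bW A).adjugate * LinearMap.toMatrix bV bW B).trace *
        oW.volumeForm bW := by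
  set e := stdONB V (d := d) with he
  set M := LinearMap.toMatrix e.toBasis bW A with hM
  set N := LinearMap.toMatrix e.toBasis bW B with hN
  set P := e.toBasis.toMatrix bV with hP
  have h1 : homInner (Cof oV oW A) B =
      oV.volumeForm e * (oW.volumeForm bW * (M.adjugate * N).trace) := by
    rw [homInner_Cof, ← he, ← sum_det_updateCol]
    congr 1
    rw [Finset.mul_sum]
    refine Finset.sum_congr rfl fun i _ => ?_
    conv_lhs => rw [AlternatingMap.eq_smul_basis_det bW oW.volumeForm]
    rw [AlternatingMap.smul_apply, smul_eq_mul, Module.Basis.det_apply]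
    congr 2
    ext k j
    by_cases hj : j = i
    · subst hj
      simp [Module.Basis.toMatrix_apply, hN, LinearMap.toMatrix_apply]
    · simp [Module.Basis.toMatrix_apply, hM, LinearMap.toMatrix_apply, hj]
  have h2 : oV.volumeForm bV = oV.volumeForm e * P.det := by
    conv_lhs => rw [AlternatingMap.eq_smul_basis_det e.toBasis oV.volumeForm]
    simp [Module.Basis.det_apply, hP]
  have h3 : LinearMap.toMatrix bV bW A = M * P :=
    (linearMap_toMatrix_mul_basis_toMatrix bV e.toBasis bW A).symm
  have h4 : LinearMap.toMatrix bV bW B = N * P :=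
    (linearMap_toMatrix_mul_basis_toMatrix bV e.toBasis bW B).symm
  have h5 : oV.volumeForm e * oV.volumeForm e = 1 := by
    rw [← abs_mul_abs_self, oV.abs_volumeForm_apply_of_orthonormal e, one_mul]
  -- Changing the basis of `V` conjugates `adj M * N` up to the factor `det P`, which is also the
  -- factor gained by the volume form of `V`.
  have h6 : ((M * P).adjugate * (N * P)).trace = P.det * (M.adjugate * N).trace := by
    rw [Matrix.adjugate_mul_distrib, Matrix.mul_assoc, Matrix.trace_mul_comm, ← Matrix.mul_assoc,
      Matrix.mul_assoc, Matrix.mul_adjugate]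
    simp
  rw [h1, h2, h3, h4, h6]
  linear_combination (oW.volumeForm bW * (M.adjugate * N).trace * P.det) * h5

/-- The Gram matrix is `Pᵀ P` for the matrix `P` of `v` in an orthonormal basis, and `|Vol v| = |det
P|`. -/
theorem sq_volumeForm {d : ℕ} [Fact (Module.finrank ℝ V = d)] (o : Orientation ℝ V (Fin d))
    (v : Fin d → V) :
    o.volumeForm v ^ 2 = (Matrix.of fun i j => inner ℝ (v i) (v j)).det := by
  set e := stdONB V (d := d)
  rw [← sq_abs, o.volumeForm_robust' e, sq_abs, Module.Basis.det_apply]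
  have : (Matrix.of fun i j => inner ℝ (v i) (v j)) =
      (e.toBasis.toMatrix v)ᵀ * e.toBasis.toMatrix v := by
    ext i j
    simp [Matrix.mul_apply, Module.Basis.toMatrix_apply, OrthonormalBasis.repr_apply_apply]
    rw [← e.sum_inner_mul_inner]
    simp [real_inner_comm]
  rw [this, Matrix.det_mul, Matrix.det_transpose, sq]

end LinearAlgebra

/-! ### Derivatives of determinants, the classical Piola identity and Jacobi's formula. -/

section Calculus

variable {d : ℕ}

/-- The determinant as a continuous multilinear function of the rows. -/
def detRow (d : ℕ) : ContinuousMultilinearMap ℝ (fun _ : Fin d => Fin d → ℝ) ℝ where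
  toMultilinearMap := Matrix.detRowAlternating.toMultilinearMap
  cont := Continuous.matrix_det (A := fun M : Matrix (Fin d) (Fin d) ℝ => M) continuous_id

theorem hasFDerivAt_det {E : Type*} [NormedAddCommGroup E] [NormedSpace ℝ E]
    {A : E → Matrix (Fin d) (Fin d) ℝ} {u : E}
    (hA : ∀ α i, DifferentiableAt ℝ (fun w => A w α i) u) :
    HasFDerivAt (fun w => (A w).det) (((detRow d).linearDeriv fun α i => A u α i).comp
      (ContinuousLinearMap.pi fun α => ContinuousLinearMap.pi fun i =>
        fderiv ℝ (fun w => A w α i) u)) u := by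
  have h1 : HasFDerivAt (fun w α i => A w α i)
      (ContinuousLinearMap.pi fun α => ContinuousLinearMap.pi fun i =>
        fderiv ℝ (fun w => A w α i) u) u := by
    rw [hasFDerivAt_pi]
    intro α
    rw [hasFDerivAt_pi]
    exact fun i => (hA α i).hasFDerivAt
  exact ((detRow d).hasFDerivAt fun α i => A u α i).comp u h1

theorem fderiv_det {E : Type*} [NormedAddCommGroup E] [NormedSpace ℝ E]
    {A : E → Matrix (Fin d) (Fin d) ℝ} {u : E}
    (hA : ∀ α i, DifferentiableAt ℝ (fun w => A w α i) u) (v : E) :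
    fderiv ℝ (fun w => (A w).det) u v =
      ∑ α, ((A u).updateRow α fun i => fderiv ℝ (fun w => A w α i) u v).det := by
  rw [(hasFDerivAt_det hA).fderiv, ContinuousLinearMap.comp_apply,
    ContinuousMultilinearMap.linearDeriv_apply]
  rfl

/-- Entries of the adjugate are themselves determinants, with one row made constant. -/
theorem differentiableAt_adjugate {E : Type*} [NormedAddCommGroup E] [NormedSpace ℝ E]
    {A : E → Matrix (Fin d) (Fin d) ℝ} {u : E}
    (hA : ∀ α i, DifferentiableAt ℝ (fun w => A w α i) u) (j γ : Fin d) :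
    DifferentiableAt ℝ (fun w => (A w).adjugate j γ) u := by
  simp_rw [Matrix.adjugate_apply]
  refine (hasFDerivAt_det fun α i => ?_).differentiableAt
  by_cases h : α = γ
  · subst h; simp
  · simpa [Matrix.updateRow_ne h] using hA α i

theorem det_updateRow_eq_sum (M : Matrix (Fin d) (Fin d) ℝ) (α : Fin d) (r : Fin d → ℝ) :
    (M.updateRow α r).det = ∑ i, r i * (M.updateRow α (Pi.single i 1)).det := by
  have h := congrFun ((Matrix.cramer Mᵀ).pi_apply_eq_sum_univ r) α
  have hs (i : Fin d) : (fun j => if i = j then (1 : ℝ) else 0) = Pi.single i 1 := by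
    ext j
    simp [Pi.single_apply, eq_comm]
  simpa [Matrix.cramer_transpose_apply, hs] using h

/-- The antisymmetric half of the cancellation in the Piola identity; `pd_jacobian_comm` is the
symmetric half. -/
theorem det_updateRow_updateRow_swap (M : Matrix (Fin d) (Fin d) ℝ) {α γ : Fin d} (h : α ≠ γ)
    (a b : Fin d → ℝ) :
    ((M.updateRow γ a).updateRow α b).det = -((M.updateRow γ b).updateRow α a).det := by
  have h1 := Matrix.det_permute (Equiv.swap α γ) ((M.updateRow γ b).updateRow α a)
  rw [Equiv.Perm.sign_swap h] at h1
  have h2 : ((M.updateRow γ b).updateRow α a).submatrix (Equiv.swap α γ) id =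
      (M.updateRow γ a).updateRow α b := by
    ext k i
    simp only [Matrix.submatrix_apply, id, Matrix.updateRow_apply]
    by_cases h2 : k = α
    · subst h2; simp [h.symm]
    · by_cases h3 : k = γ
      · subst h3; simp [h2]
      · simp [Equiv.swap_apply_of_ne_of_ne h2 h3, h2, h3]
  rw [← h2, h1]
  simp

/-- The matrix of partial derivatives. -/
def jacobian (F : Coord d → Coord d) (u : Coord d) : Matrix (Fin d) (Fin d) ℝ :=
  Matrix.of fun α i => pd i (fun w => F w α) u

theorem contDiffAt_component {n : WithTop ℕ∞} {F : Coord d → Coord d} {u : Coord d}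
    (hF : ContDiffAt ℝ n F u) (α : Fin d) : ContDiffAt ℝ n (fun w => F w α) u :=
  contDiffAt_euclidean.1 hF α

theorem contDiffAt_jacobian {F : Coord d → Coord d} {u : Coord d} (hF : ContDiffAt ℝ 2 F u)
    (α i : Fin d) : ContDiffAt ℝ 1 (fun w => jacobian F w α i) u :=
  ((contDiffAt_component hF α).fderiv_right (m := 1) (by norm_num)).clm_apply contDiffAt_const

theorem pd_jacobian_comm {F : Coord d → Coord d} {u : Coord d} (hF : ContDiffAt ℝ 2 F u)
    (α i j : Fin d) :
    pd j (fun w => jacobian F w α i) u = pd i (fun w => jacobian F w α j) u := by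
  have hs : IsSymmSndFDerivAt ℝ (fun w => F w α) u :=
    (contDiffAt_component hF α).isSymmSndFDerivAt (by simp)
  have hd : DifferentiableAt ℝ (fderiv ℝ fun w => F w α) u :=
    ((contDiffAt_component hF α).fderiv_right (m := 1) (by norm_num)).differentiableAt (by simp)
  have h (k l : Fin d) : pd k (fun w => jacobian F w α l) u =
      fderiv ℝ (fderiv ℝ fun w => F w α) u (stdVec k) (stdVec l) := by
    simp only [pd, jacobian, Matrix.of_apply]
    rw [fderiv_clm_apply hd (by fun_prop)]
    simp
  rw [h, h, hs.eq]

/-- The classical Piola identity: the cofactor matrix of a Jacobian matrix is divergence free. -/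
theorem sum_pd_adjugate_jacobian {F : Coord d → Coord d} {u : Coord d} (hF : ContDiffAt ℝ 2 F u)
    (γ : Fin d) : ∑ j, pd j (fun w => (jacobian F w).adjugate j γ) u = 0 := by
  have hJ (α i : Fin d) : DifferentiableAt ℝ (fun w => jacobian F w α i) u :=
    (contDiffAt_jacobian hF α i).differentiableAt (by simp)
  set M := jacobian F u with hM
  have h1 (j : Fin d) : pd j (fun w => (jacobian F w).adjugate j γ) u =
      ∑ α, if α = γ then 0 else ∑ i, pd j (fun w => jacobian F w α i) u *
        ((M.updateRow γ (Pi.single j 1)).updateRow α (Pi.single i 1)).det := by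
    simp_rw [Matrix.adjugate_apply, pd]
    rw [fderiv_det]
    · refine Finset.sum_congr rfl fun α _ => ?_
      split_ifs with h
      · subst h
        -- Row `γ` is the constant `e_j`, so differentiating it leaves a zero row.
        refine Matrix.det_eq_zero_of_row_eq_zero α fun i => ?_
        simp
      · rw [det_updateRow_eq_sum]
        simp [Matrix.updateRow_ne h, hM]
    · intro α i
      by_cases h : α = γ
      · subst h; simp
      · simpa [Matrix.updateRow_ne h] using hJ α i
  simp_rw [h1]
  rw [Finset.sum_comm]
  refine Finset.sum_eq_zero fun α _ => ?_
  by_cases h : α = γ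
  · simp [h]
  simp only [h, if_false]
  -- Exchanging the names `i` and `j` shows that the sum is its own negative.
  have h2 : ∑ j, ∑ i, pd j (fun w => jacobian F w α i) u *
        ((M.updateRow γ (Pi.single j 1)).updateRow α (Pi.single i 1)).det =
      -∑ j, ∑ i, pd j (fun w => jacobian F w α i) u *
        ((M.updateRow γ (Pi.single j 1)).updateRow α (Pi.single i 1)).det := by
    conv_lhs => rw [Finset.sum_comm]
    simp_rw [← Finset.sum_neg_distrib]
    refine Finset.sum_congr rfl fun i _ => Finset.sum_congr rfl fun j _ => ?_
    rw [det_updateRow_updateRow_swap M h, pd_jacobian_comm hF]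
    ring
  linarith

/-- Jacobi's formula for the square root of the determinant. -/
theorem pd_sqrt_det {G : Coord d → Matrix (Fin d) (Fin d) ℝ} {v : Coord d}
    (hG : ∀ α β, DifferentiableAt ℝ (fun w => G w α β) v) (hdet : 0 < (G v).det) (γ : Fin d) :
    pd γ (fun w => √(G w).det) v =
      √(G v).det * ((1 / 2) * ∑ β, ∑ δ, (G v)⁻¹ β δ * pd γ (fun w => G w δ β) v) := by
  have h1 : pd γ (fun w => (G w).det) v =
      (G v).det * ∑ β, ∑ δ, (G v)⁻¹ β δ * pd γ (fun w => G w δ β) v := by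
    rw [pd, fderiv_det hG]
    -- Laplace expansion along the differentiated row turns `∂ det G` into `tr (adj G ∂G)`.
    have hs (α : Fin d) (r : Fin d → ℝ) :
        ((G v).updateRow α r).det = ∑ i, r i * (G v).adjugate i α := by
      simp_rw [Matrix.adjugate_apply]
      exact det_updateRow_eq_sum _ _ _
    simp_rw [hs, Finset.mul_sum]
    rw [Finset.sum_comm]
    refine Finset.sum_congr rfl fun i _ => Finset.sum_congr rfl fun j _ => ?_
    rw [Matrix.inv_def, Ring.inverse_eq_inv']
    simp only [Matrix.smul_apply, smul_eq_mul, pd]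
    field_simp
  have h2 := (hasFDerivAt_det hG).sqrt hdet.ne'
  have h3 : pd γ (fun w => √(G w).det) v =
      (1 / (2 * √(G v).det)) * pd γ (fun w => (G w).det) v := by
    rw [pd, h2.fderiv, pd, (hasFDerivAt_det hG).fderiv]
    rfl
  rw [h3, h1]
  have h4 : 0 < √(G v).det := Real.sqrt_pos.2 hdet
  nth_rewrite 2 [← Real.mul_self_sqrt hdet.le]
  field_simp

end Calculus

/-! ### Christoffel symbols of a matrix-valued function and their transformation law. -/

section Christoffel

variable {d : ℕ}

instance : NormedAddCommGroup (Coord d →L[ℝ] ℝ) := ContinuousLinearMap.toNormedAddCommGroup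

instance : NormedSpace ℝ (Coord d →L[ℝ] ℝ) := ContinuousLinearMap.toNormedSpace

instance : NormedAddCommGroup (Coord d →L[ℝ] Coord d →L[ℝ] ℝ) :=
  ContinuousLinearMap.toNormedAddCommGroup

instance : NormedSpace ℝ (Coord d →L[ℝ] Coord d →L[ℝ] ℝ) := ContinuousLinearMap.toNormedSpace

theorem coord_eq_sum (a : Coord d) : a = ∑ i, a i • stdVec i := by
  conv_lhs => rw [← (EuclideanSpace.basisFun (Fin d) ℝ).sum_repr a]
  simp [stdVec]

theorem stdVec_apply (i j : Fin d) : (stdVec i : Coord d) j = if j = i then 1 else 0 := by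
  simp [stdVec]

theorem fderiv_eq_sum_pd (φ : Coord d → ℝ) (v a : Coord d) :
    fderiv ℝ φ v a = ∑ i, a i * pd i φ v := by
  conv_lhs => rw [coord_eq_sum a]
  simp [pd]

/-- The bilinear form on `ℝᵈ` with a given matrix. -/
def bil (M : Matrix (Fin d) (Fin d) ℝ) : Coord d →L[ℝ] Coord d →L[ℝ] ℝ :=
  ∑ α, ∑ β, M α β • (EuclideanSpace.proj (𝕜 := ℝ) α : Coord d →L[ℝ] ℝ).smulRight
    (EuclideanSpace.proj (𝕜 := ℝ) β : Coord d →L[ℝ] ℝ)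

theorem bil_apply (M : Matrix (Fin d) (Fin d) ℝ) (a b : Coord d) :
    bil M a b = ∑ α, ∑ β, M α β * (a α * b β) := by
  simp [bil]

theorem bil_eq_dotProduct (M : Matrix (Fin d) (Fin d) ℝ) (a b : Coord d) :
    bil M a b = a.ofLp ⬝ᵥ M *ᵥ b.ofLp := by
  rw [bil_apply]
  simp only [dotProduct, Matrix.mulVec, Finset.mul_sum]
  exact Finset.sum_congr rfl fun _ _ => Finset.sum_congr rfl fun _ _ => by ring

theorem bil_comm {M : Matrix (Fin d) (Fin d) ℝ} (hM : Mᵀ = M) (a b : Coord d) :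
    bil M a b = bil M b a := by
  rw [bil_apply, bil_apply, Finset.sum_comm]
  refine Finset.sum_congr rfl fun α _ => Finset.sum_congr rfl fun β _ => ?_
  rw [show M β α = M α β from congrFun (congrFun hM α) β]
  ring

theorem eq_of_bil_eq {M : Matrix (Fin d) (Fin d) ℝ} (hM : IsUnit M.det) {a b : Coord d}
    (h : ∀ c, bil M c a = bil M c b) : a = b := by
  have h1 : M *ᵥ a.ofLp = M *ᵥ b.ofLp := by
    ext i
    simpa [bil_eq_dotProduct, stdVec] using h (stdVec i)
  have h2 := congrArg (M⁻¹ *ᵥ ·) h1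
  simp only [Matrix.mulVec_mulVec, Matrix.nonsing_inv_mul _ hM, Matrix.one_mulVec] at h2
  exact WithLp.ofLp_injective 2 h2

theorem hasFDerivAt_bil {G : Coord d → Matrix (Fin d) (Fin d) ℝ} {v : Coord d}
    (hG : ∀ α β, DifferentiableAt ℝ (fun w => G w α β) v) :
    DifferentiableAt ℝ (fun w => bil (G w)) v ∧ ∀ c,
      fderiv ℝ (fun w => bil (G w)) v c =
        bil (Matrix.of fun α β => fderiv ℝ (fun w => G w α β) v c) := by
  have h : HasFDerivAt (fun w => bil (G w)) (∑ α, ∑ β, (fderiv ℝ (fun w => G w α β) v).smulRight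
      ((EuclideanSpace.proj (𝕜 := ℝ) α : Coord d →L[ℝ] ℝ).smulRight
        (EuclideanSpace.proj (𝕜 := ℝ) β : Coord d →L[ℝ] ℝ))) v := by
    unfold bil
    refine HasFDerivAt.fun_sum fun α _ => HasFDerivAt.fun_sum fun β _ => ?_
    exact (hG α β).hasFDerivAt.smul_const _
  refine ⟨h.differentiableAt, fun c => ?_⟩
  rw [h.fderiv]
  simp [bil]

/-- The Christoffel symbols of a matrix-valued function `G`. -/
def christoffelOf (G : Coord d → Matrix (Fin d) (Fin d) ℝ) (α β γ : Fin d) (v : Coord d) : ℝ :=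
  (1 / 2) * ∑ δ, (G v)⁻¹ α δ *
    (pd β (fun w => G w δ γ) v + pd γ (fun w => G w δ β) v - pd δ (fun w => G w β γ) v)

/-- The vector `Γ(a, b)` with components `Γ^α_{βγ} a^β b^γ`. -/
def christoffelVec (G : Coord d → Matrix (Fin d) (Fin d) ℝ) (v a b : Coord d) : Coord d :=
  WithLp.toLp 2 fun α => ∑ β, ∑ γ, christoffelOf G α β γ v * (a β * b γ)

/-- The Koszul formula for coordinate fields: pairing with `G` cancels the inverse matrix in the
Christoffel symbols. In this form a change of coordinates can be computed without inverse matrices.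
-/
theorem bil_christoffelVec {G : Coord d → Matrix (Fin d) (Fin d) ℝ} {v : Coord d}
    (hG : ∀ α β, DifferentiableAt ℝ (fun w => G w α β) v) (hdet : IsUnit (G v).det)
    (a b c : Coord d) :
    bil (G v) c (christoffelVec G v a b) = (1 / 2) *
      (fderiv ℝ (fun w => bil (G w)) v a c b + fderiv ℝ (fun w => bil (G w)) v b c a
        - fderiv ℝ (fun w => bil (G w)) v c a b) := by
  set k : Fin d → ℝ := fun δ => ∑ β, ∑ γ, (1 / 2) * (pd β (fun w => G w δ γ) v +
    pd γ (fun w => G w δ β) v - pd δ (fun w => G w β γ) v) * (a β * b γ) with hk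
  have h1 : (christoffelVec G v a b).ofLp = (G v)⁻¹ *ᵥ k := by
    ext α
    simp only [christoffelVec, christoffelOf, Matrix.mulVec, dotProduct, hk, Finset.mul_sum,
      Finset.sum_mul]
    rw [Finset.sum_comm_cycle]
    exact Finset.sum_congr rfl fun _ _ => Finset.sum_congr rfl fun _ _ =>
      Finset.sum_congr rfl fun _ _ => by ring
  rw [bil_eq_dotProduct, h1, Matrix.mulVec_mulVec, Matrix.mul_nonsing_inv _ hdet, Matrix.one_mulVec]
  simp only [(hasFDerivAt_bil hG).2, bil_apply, Matrix.of_apply, fderiv_eq_sum_pd, dotProduct, hk,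
    Finset.mul_sum, Finset.sum_mul]
  have e1 : ∑ δ, ∑ γ, ∑ β, a β * pd β (fun w => G w δ γ) v * (c δ * b γ) =
      ∑ δ, ∑ β, ∑ γ, a β * pd β (fun w => G w δ γ) v * (c δ * b γ) :=
    Finset.sum_congr rfl fun _ _ => Finset.sum_comm
  have e3 : ∑ β, ∑ γ, ∑ δ, c δ * pd δ (fun w => G w β γ) v * (a β * b γ) =
      ∑ δ, ∑ β, ∑ γ, c δ * pd δ (fun w => G w β γ) v * (a β * b γ) := by
    rw [Finset.sum_comm_cycle]
  rw [e1, e3, ← Finset.sum_add_distrib, ← Finset.sum_sub_distrib, Finset.mul_sum]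
  refine Finset.sum_congr rfl fun δ _ => ?_
  rw [← Finset.sum_add_distrib, ← Finset.sum_sub_distrib, Finset.mul_sum]
  refine Finset.sum_congr rfl fun β _ => ?_
  rw [← Finset.sum_add_distrib, ← Finset.sum_sub_distrib, Finset.mul_sum]
  exact Finset.sum_congr rfl fun γ _ => by ring

/-- The transformation law of the Christoffel symbols under a change of coordinates `ψ`. -/
theorem christoffelVec_transform {G G' : Coord d → Matrix (Fin d) (Fin d) ℝ}
    {ψ : Coord d → Coord d} {v : Coord d} (hψ : ContDiffAt ℝ 2 ψ v)
    (hG : ∀ α β, DifferentiableAt ℝ (fun w => G w α β) v)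
    (hG' : ∀ α β, DifferentiableAt ℝ (fun w => G' w α β) (ψ v))
    (hdet : IsUnit (G v).det) (hdet' : IsUnit (G' (ψ v)).det)
    (hsymm : ∀ w, (G' w)ᵀ = G' w) (hsurj : Function.Surjective (fderiv ℝ ψ v))
    (h : ∀ᶠ w in nhds v, ∀ a b,
      bil (G w) a b = bil (G' (ψ w)) (fderiv ℝ ψ w a) (fderiv ℝ ψ w b)) (a b : Coord d) :
    fderiv ℝ ψ v (christoffelVec G v a b) = fderiv ℝ (fderiv ℝ ψ) v a b +
      christoffelVec G' (ψ v) (fderiv ℝ ψ v a) (fderiv ℝ ψ v b) := by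
  have hψ1 : DifferentiableAt ℝ ψ v := hψ.differentiableAt (by simp)
  have hψ2 : DifferentiableAt ℝ (fderiv ℝ ψ) v :=
    (hψ.fderiv_right (m := 1) (by norm_num)).differentiableAt (by simp)
  have hs : ∀ a b, fderiv ℝ (fderiv ℝ ψ) v a b = fderiv ℝ (fderiv ℝ ψ) v b a := fun a b =>
    (hψ.isSymmSndFDerivAt (by simp)).eq a b
  have hB' : DifferentiableAt ℝ (fun w => bil (G' w)) (ψ v) := (hasFDerivAt_bil hG').1
  have hB : DifferentiableAt ℝ (fun w => bil (G w)) v := (hasFDerivAt_bil hG).1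
  -- The isometry condition `h` is differentiated in the direction `c`. In the Koszul combination of
  -- three such identities all second derivatives of `ψ` cancel except `D²ψ(a, b)`.
  have key (c a b : Coord d) : fderiv ℝ (fun w => bil (G w)) v c a b =
      fderiv ℝ (fun w => bil (G' w)) (ψ v) (fderiv ℝ ψ v c) (fderiv ℝ ψ v a) (fderiv ℝ ψ v b) +
      bil (G' (ψ v)) (fderiv ℝ (fderiv ℝ ψ) v c a) (fderiv ℝ ψ v b) +
      bil (G' (ψ v)) (fderiv ℝ ψ v a) (fderiv ℝ (fderiv ℝ ψ) v c b) := by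
    have e1 : fderiv ℝ (fun w => bil (G w) a b) v c = fderiv ℝ (fun w => bil (G w)) v c a b := by
      have := ((hB.hasFDerivAt.clm_apply (hasFDerivAt_const a v)).clm_apply
        (hasFDerivAt_const b v)).fderiv
      rw [this]
      simp
    have e2 : (fun w => bil (G w) a b) =ᶠ[nhds v]
        fun w => bil (G' (ψ w)) (fderiv ℝ ψ w a) (fderiv ℝ ψ w b) := h.mono fun w hw => hw a b
    have e3 (z : Coord d) := hψ2.hasFDerivAt.clm_apply (hasFDerivAt_const z v)
    have e4 := ((hB'.hasFDerivAt.comp v hψ1.hasFDerivAt).clm_apply (e3 a)).clm_apply (e3 b)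
    rw [← e1, e2.fderiv_eq]
    erw [e4.fderiv]
    simp
    ring
  refine eq_of_bil_eq hdet' fun z => ?_
  obtain ⟨c, rfl⟩ := hsurj z
  rw [← h.self_of_nhds, bil_christoffelVec hG hdet, map_add, bil_christoffelVec hG' hdet',
    key, key, key, hs c a, hs c b, hs b a, bil_comm (hsymm _) (fderiv ℝ (fderiv ℝ ψ) v a c),
    bil_comm (hsymm _) (fderiv ℝ (fderiv ℝ ψ) v b c)]
  ring

/-- The contracted Christoffel symbols of a symmetric matrix-valued function. -/
theorem sum_christoffelOf {G : Coord d → Matrix (Fin d) (Fin d) ℝ} (hsymm : ∀ w, (G w)ᵀ = G w)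
    (v : Coord d) (γ : Fin d) :
    ∑ β, christoffelOf G β β γ v = (1 / 2) * ∑ β, ∑ δ, (G v)⁻¹ β δ * pd γ (fun w => G w δ β) v := by
  have hs (w : Coord d) (α β : Fin d) : G w α β = G w β α := congrFun (congrFun (hsymm w) β) α
  have hinv (α β : Fin d) : (G v)⁻¹ α β = (G v)⁻¹ β α := by
    have : ((G v)⁻¹)ᵀ = (G v)⁻¹ := by rw [Matrix.transpose_nonsing_inv, hsymm]
    exact congrFun (congrFun this β) α
  -- After contraction the first and third terms of the Christoffel symbol cancel, by symmetry of
  -- the inverse matrix.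
  have h : ∑ β, ∑ δ, (G v)⁻¹ β δ * pd β (fun w => G w δ γ) v =
      ∑ β, ∑ δ, (G v)⁻¹ β δ * pd δ (fun w => G w β γ) v := by
    rw [Finset.sum_comm]
    exact Finset.sum_congr rfl fun β _ => Finset.sum_congr rfl fun δ _ => by rw [hinv]
  simp only [christoffelOf, ← Finset.mul_sum, mul_add, mul_sub, Finset.sum_add_distrib,
    Finset.sum_sub_distrib, h]
  ring

end Christoffel

/-! ### Differentials of charts, coordinate frames and transition maps. -/

section Charts

variable {d : ℕ} {M : Type*} [TopologicalSpace M] [ChartedSpace (Coord d) M]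

/-- The differential of a chart, with values in `ℝᵈ`. -/
def dchart (y : OpenPartialHomeomorph M (Coord d)) (q : M) :
    TangentSpace (𝓡 d) q →ₗ[ℝ] Coord d :=
  (mfderiv (𝓡 d) (𝓡 d) y q).toLinearMap

/-- The differential of the inverse of a chart. -/
def dsymm (y : OpenPartialHomeomorph M (Coord d)) (v : Coord d) :
    Coord d →ₗ[ℝ] TangentSpace (𝓡 d) (y.symm v) :=
  (mfderiv (𝓡 d) (𝓡 d) y.symm v).toLinearMap

theorem comp_eq_dchart (y : OpenPartialHomeomorph M (Coord d)) (q : M) (α : Fin d)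
    (z : TangentSpace (𝓡 d) q) : comp y q α z = dchart y q z α := rfl

set_option linter.unusedSectionVars false

variable [IsManifold (𝓡 d) ∞ M]

theorem mdifferentiable_of_mem_maximalAtlas {y : OpenPartialHomeomorph M (Coord d)}
    (hy : y ∈ IsManifold.maximalAtlas (𝓡 d) ∞ M) : y.MDifferentiable (𝓡 d) (𝓡 d) :=
  ⟨(contMDiffOn_of_mem_maximalAtlas hy).mdifferentiableOn (by simp),
    (contMDiffOn_symm_of_mem_maximalAtlas hy).mdifferentiableOn (by simp)⟩

theorem isInvertible_mfderiv {y : OpenPartialHomeomorph M (Coord d)}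
    (hy : y ∈ IsManifold.maximalAtlas (𝓡 d) ∞ M) {q : M} (hq : q ∈ y.source) :
    (mfderiv (𝓡 d) (𝓡 d) y q).IsInvertible :=
  ⟨(mdifferentiable_of_mem_maximalAtlas hy).mfderiv hq, rfl⟩

theorem dchart_frame {y : OpenPartialHomeomorph M (Coord d)}
    (hy : y ∈ IsManifold.maximalAtlas (𝓡 d) ∞ M) {q : M} (hq : q ∈ y.source) (α : Fin d) :
    dchart y q (frame y q α) = stdVec α :=
  (isInvertible_mfderiv hy hq).self_apply_inverse (stdVec α)

theorem dchart_injective {y : OpenPartialHomeomorph M (Coord d)}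
    (hy : y ∈ IsManifold.maximalAtlas (𝓡 d) ∞ M) {q : M} (hq : q ∈ y.source) :
    Function.Injective (dchart y q) :=
  (isInvertible_mfderiv hy hq).injective

theorem dchart_dsymm {y : OpenPartialHomeomorph M (Coord d)}
    (hy : y ∈ IsManifold.maximalAtlas (𝓡 d) ∞ M) {v : Coord d} (hv : v ∈ y.target) (a : Coord d) :
    dchart y (y.symm v) (dsymm y v a) = a :=
  congrArg (fun L => L a) ((mdifferentiable_of_mem_maximalAtlas hy).comp_symm_deriv hv)

theorem frame_symm {y : OpenPartialHomeomorph M (Coord d)}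
    (hy : y ∈ IsManifold.maximalAtlas (𝓡 d) ∞ M) {v : Coord d} (hv : v ∈ y.target) (α : Fin d) :
    frame y (y.symm v) α = dsymm y v (stdVec α) := by
  apply dchart_injective hy (y.map_target hv)
  rw [dchart_frame hy (y.map_target hv), dchart_dsymm hy hv]

theorem sum_dchart_smul_frame {y : OpenPartialHomeomorph M (Coord d)}
    (hy : y ∈ IsManifold.maximalAtlas (𝓡 d) ∞ M) {q : M} (hq : q ∈ y.source)
    (z : TangentSpace (𝓡 d) q) : ∑ α, dchart y q z α • frame y q α = z := by
  apply dchart_injective hy hq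
  simp only [map_sum, map_smul, dchart_frame hy hq]
  exact (coord_eq_sum _).symm

/-- The coordinate frame as a basis of the tangent space. -/
def frameBasis {y : OpenPartialHomeomorph M (Coord d)}
    (hy : y ∈ IsManifold.maximalAtlas (𝓡 d) ∞ M) {q : M} (hq : q ∈ y.source) :
    Module.Basis (Fin d) ℝ (TangentSpace (𝓡 d) q) :=
  (EuclideanSpace.basisFun (Fin d) ℝ).toBasis.map
    (LinearEquiv.ofBijective (dchart y q) ((isInvertible_mfderiv hy hq).bijective)).symm

theorem coe_frameBasis {y : OpenPartialHomeomorph M (Coord d)}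
    (hy : y ∈ IsManifold.maximalAtlas (𝓡 d) ∞ M) {q : M} (hq : q ∈ y.source) :
    ⇑(frameBasis hy hq) = frame y q := by
  ext1 α
  apply dchart_injective hy hq
  rw [dchart_frame hy hq]
  simp only [frameBasis, Module.Basis.map_apply]
  exact (LinearEquiv.ofBijective (dchart y q) _).apply_symm_apply _ |>.trans (by simp [stdVec])

theorem frameBasis_repr {y : OpenPartialHomeomorph M (Coord d)}
    (hy : y ∈ IsManifold.maximalAtlas (𝓡 d) ∞ M) {q : M} (hq : q ∈ y.source)
    (z : TangentSpace (𝓡 d) q) (α : Fin d) : (frameBasis hy hq).repr z α = dchart y q z α := by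
  conv_lhs => rw [← sum_dchart_smul_frame hy hq z, ← coe_frameBasis hy hq]
  simp [Finsupp.single_apply]

/-- Transition between two charts. -/
theorem dchart_eq_fderiv_transition {y y' : OpenPartialHomeomorph M (Coord d)}
    (hy : y ∈ IsManifold.maximalAtlas (𝓡 d) ∞ M) (hy' : y' ∈ IsManifold.maximalAtlas (𝓡 d) ∞ M)
    {q : M} (hq : q ∈ y.source) (hq' : q ∈ y'.source) (z : TangentSpace (𝓡 d) q) :
    dchart y' q z = fderiv ℝ (y' ∘ y.symm) (y q) (dchart y q z) := by
  have h1 : MDifferentiableAt (𝓡 d) (𝓡 d) (y' ∘ y.symm) (y q) := by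
    refine MDifferentiableAt.comp (I' := 𝓡 d) (y q) ?_
      ((mdifferentiable_of_mem_maximalAtlas hy).mdifferentiableAt_symm (y.map_source hq))
    rw [y.left_inv hq]
    exact (mdifferentiable_of_mem_maximalAtlas hy').mdifferentiableAt hq'
  have h2 := mfderiv_comp q h1 ((mdifferentiable_of_mem_maximalAtlas hy).mdifferentiableAt hq)
  have h3 : mfderiv (𝓡 d) (𝓡 d) ((y' ∘ y.symm) ∘ y) q = mfderiv (𝓡 d) (𝓡 d) y' q := by
    apply Filter.EventuallyEq.mfderiv_eq
    filter_upwards [y.open_source.mem_nhds hq] with r hr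
    simp [y.left_inv hr]
  rw [h3] at h2
  rw [← mfderiv_eq_fderiv]
  exact congrArg (fun L => L z) h2

theorem dchart_comp_dsymm {y y' : OpenPartialHomeomorph M (Coord d)}
    (hy : y ∈ IsManifold.maximalAtlas (𝓡 d) ∞ M) (hy' : y' ∈ IsManifold.maximalAtlas (𝓡 d) ∞ M)
    {v : Coord d} (hv : v ∈ y.target) (hv' : y.symm v ∈ y'.source) (a : Coord d) :
    dchart y' (y.symm v) (dsymm y v a) = fderiv ℝ (y' ∘ y.symm) v a := by
  rw [dchart_eq_fderiv_transition hy hy' (y.map_target hv) hv', y.right_inv hv, dchart_dsymm hy hv]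

theorem contDiffAt_transition {y y' : OpenPartialHomeomorph M (Coord d)}
    (hy : y ∈ IsManifold.maximalAtlas (𝓡 d) ∞ M) (hy' : y' ∈ IsManifold.maximalAtlas (𝓡 d) ∞ M)
    {v : Coord d} (hv : v ∈ y.target) (hv' : y.symm v ∈ y'.source) :
    ContDiffAt ℝ ∞ (y' ∘ y.symm) v :=
  ((contMDiffAt_of_mem_maximalAtlas hy' hv').comp v
    (contMDiffAt_symm_of_mem_maximalAtlas hy hv)).contDiffAt

theorem fderiv_transition_bijective {y y' : OpenPartialHomeomorph M (Coord d)}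
    (hy : y ∈ IsManifold.maximalAtlas (𝓡 d) ∞ M) (hy' : y' ∈ IsManifold.maximalAtlas (𝓡 d) ∞ M)
    {v : Coord d} (hv : v ∈ y.target) (hv' : y.symm v ∈ y'.source) :
    Function.Bijective (fderiv ℝ (y' ∘ y.symm) v) := by
  have h : (fderiv ℝ (y' ∘ y.symm) v : Coord d → Coord d) =
      dchart y' (y.symm v) ∘ dsymm y v := by
    ext1 a
    exact (dchart_comp_dsymm hy hy' hv hv' a).symm
  rw [h]
  exact (isInvertible_mfderiv hy' hv').bijective.comp
    ((mdifferentiable_of_mem_maximalAtlas hy).symm.mfderiv_bijective hv)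

/-- Smoothness of coordinate fields as sections of the tangent bundle; the smooth metric then has
smooth coefficients. -/
theorem contMDiffOn_dsymm {y : OpenPartialHomeomorph M (Coord d)}
    (hy : y ∈ IsManifold.maximalAtlas (𝓡 d) ∞ M) (a : Coord d) :
    ContMDiffOn (𝓡 d) (𝓡 d).tangent ∞
      (fun v => (⟨y.symm v, dsymm y v a⟩ : TangentBundle (𝓡 d) M)) y.target := by
  have h1 := (contMDiffOn_symm_of_mem_maximalAtlas hy).contMDiffOn_tangentMapWithin
    (m := ∞) (by rfl) y.open_target.uniqueMDiffOn
  have h2 : ContMDiff (𝓡 d) (𝓡 d).tangent ∞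
      (fun v : Coord d => (⟨v, a⟩ : TangentBundle (𝓡 d) (Coord d))) :=
    contMDiff_vectorSpace_iff_contDiff.2 contDiff_const
  refine (h1.comp h2.contMDiffOn (fun v hv => hv)).congr fun v hv => ?_
  simp only [Function.comp_apply, tangentMapWithin, dsymm]
  rw [mfderivWithin_of_isOpen y.open_target hv]
  rfl

end Charts

/-! ### The metric and the volume density in a chart. -/

section Metric

set_option linter.unusedSectionVars false

variable {d : ℕ} {M : Type*} [TopologicalSpace M] [ChartedSpace (Coord d) M]
  [IsManifold (𝓡 d) ∞ M] [RiemannianBundle (fun p : M => TangentSpace (𝓡 d) p)]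

theorem gram_transpose (y : OpenPartialHomeomorph M (Coord d)) (v : Coord d) :
    (gram y v)ᵀ = gram y v := by
  ext α β
  simp [gram, real_inner_comm]

theorem bil_gram {y : OpenPartialHomeomorph M (Coord d)}
    (hy : y ∈ IsManifold.maximalAtlas (𝓡 d) ∞ M) {v : Coord d} (hv : v ∈ y.target)
    (a b : Coord d) : bil (gram y v) a b = inner ℝ (dsymm y v a) (dsymm y v b) := by
  have h (c : Coord d) : dsymm y v c = ∑ i, c i • frame y (y.symm v) i := by
    conv_lhs => rw [coord_eq_sum c]
    simp only [map_sum, map_smul, frame_symm hy hv]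
  rw [h, h, sum_inner, bil_apply]
  refine Finset.sum_congr rfl fun α _ => ?_
  rw [inner_sum]
  refine Finset.sum_congr rfl fun β _ => ?_
  rw [real_inner_smul_left, real_inner_smul_right]
  simp only [gram, Matrix.of_apply]
  ring

theorem bil_gram_dchart {y : OpenPartialHomeomorph M (Coord d)}
    (hy : y ∈ IsManifold.maximalAtlas (𝓡 d) ∞ M) {q : M} (hq : q ∈ y.source)
    (z z' : TangentSpace (𝓡 d) q) :
    bil (gram y (y q)) (dchart y q z) (dchart y q z') = inner ℝ z z' := by
  obtain ⟨v, hv, rfl⟩ : ∃ v ∈ y.target, q = y.symm v := ⟨y q, y.map_source hq, (y.left_inv hq).symm⟩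
  have h (z : TangentSpace (𝓡 d) (y.symm v)) : dsymm y v (dchart y (y.symm v) z) = z :=
    dchart_injective hy hq (dchart_dsymm hy hv _)
  rw [y.right_inv hv, bil_gram hy hv, h, h]

theorem det_gram_eq_sq (y : OpenPartialHomeomorph M (Coord d)) (v : Coord d)
    (o : Orientation ℝ (TangentSpace (𝓡 d) (y.symm v)) (Fin d)) :
    (gram y v).det = o.volumeForm (frame y (y.symm v)) ^ 2 :=
  (sq_volumeForm o _).symm

theorem det_gram_pos {y : OpenPartialHomeomorph M (Coord d)}
    (hy : y ∈ IsManifold.maximalAtlas (𝓡 d) ∞ M) {v : Coord d} (hv : v ∈ y.target) :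
    0 < (gram y v).det := by
  set b := frameBasis hy (y.map_target hv)
  -- Any orientation serves here, since only the square of the volume form appears.
  have h1 := det_gram_eq_sq y v b.orientation
  have h2 := b.orientation.volumeForm_robust' (stdONB (TangentSpace (𝓡 d) (y.symm v)) (d := d)) b
  have h3 := (stdONB (TangentSpace (𝓡 d) (y.symm v)) (d := d)).toBasis.isUnit_det b
  rw [h1, ← sq_abs, ← coe_frameBasis hy (y.map_target hv), h2, sq_abs]
  exact sq_pos_of_ne_zero h3.ne_zero

theorem density_pos {y : OpenPartialHomeomorph M (Coord d)}
    (hy : y ∈ IsManifold.maximalAtlas (𝓡 d) ∞ M) {v : Coord d} (hv : v ∈ y.target) :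
    0 < density y v :=
  Real.sqrt_pos.2 (det_gram_pos hy hv)

theorem volumeForm_frame_of_isPositiveChart {y : OpenPartialHomeomorph M (Coord d)}
    {o : ∀ p : M, Orientation ℝ (TangentSpace (𝓡 d) p) (Fin d)} (hpos : IsPositiveChart o y)
    {q : M} (hq : q ∈ y.source) : (o q).volumeForm (frame y q) = density y (y q) := by
  obtain ⟨v, hv, rfl⟩ : ∃ v ∈ y.target, q = y.symm v := ⟨y q, y.map_source hq, (y.left_inv hq).symm⟩
  rw [y.right_inv hv, density, det_gram_eq_sq y v (o (y.symm v)), Real.sqrt_sq (hpos _ hq).le]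

variable [IsContMDiffRiemannianBundle (𝓡 d) ∞ (Coord d) (fun p : M => TangentSpace (𝓡 d) p)]

theorem contDiffOn_gram {y : OpenPartialHomeomorph M (Coord d)}
    (hy : y ∈ IsManifold.maximalAtlas (𝓡 d) ∞ M) (α β : Fin d) :
    ContDiffOn ℝ ∞ (fun v => gram y v α β) y.target := by
  have h := (contMDiffOn_dsymm hy (stdVec α)).inner_bundle (contMDiffOn_dsymm hy (stdVec β))
  refine (contMDiffOn_iff_contDiffOn.1 h).congr fun v hv => ?_
  simp only [gram, Matrix.of_apply, frame_symm hy hv]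

theorem contDiffAt_gram {y : OpenPartialHomeomorph M (Coord d)}
    (hy : y ∈ IsManifold.maximalAtlas (𝓡 d) ∞ M) {v : Coord d} (hv : v ∈ y.target) (α β : Fin d) :
    ContDiffAt ℝ ∞ (fun v => gram y v α β) v :=
  (contDiffOn_gram hy α β).contDiffAt (y.open_target.mem_nhds hv)

theorem differentiableAt_gram {y : OpenPartialHomeomorph M (Coord d)}
    (hy : y ∈ IsManifold.maximalAtlas (𝓡 d) ∞ M) {v : Coord d} (hv : v ∈ y.target) (α β : Fin d) :
    DifferentiableAt ℝ (fun v => gram y v α β) v :=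
  (contDiffAt_gram hy hv α β).differentiableAt (by simp)

theorem contDiffAt_density {y : OpenPartialHomeomorph M (Coord d)}
    (hy : y ∈ IsManifold.maximalAtlas (𝓡 d) ∞ M) {v : Coord d} (hv : v ∈ y.target) :
    ContDiffAt ℝ ∞ (density y) v := by
  refine ContDiffAt.sqrt ?_ (det_gram_pos hy hv).ne'
  simp_rw [Matrix.det_apply]
  refine ContDiffAt.sum fun σ _ => ContDiffAt.const_smul _ (contDiffAt_prod fun i _ => ?_)
  exact contDiffAt_gram hy hv _ _

/-- Both sides are half the trace of `h⁻¹ ∂_γ h`, times the density: Jacobi's formula on the left,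
the contracted Christoffel symbol on the right. -/
theorem pd_density {y : OpenPartialHomeomorph M (Coord d)}
    (hy : y ∈ IsManifold.maximalAtlas (𝓡 d) ∞ M) {v : Coord d} (hv : v ∈ y.target) (γ : Fin d) :
    pd γ (density y) v = density y v * ∑ β, christoffel y β β γ v := by
  have h := sum_christoffelOf (gram_transpose y) v γ
  change ∑ β, christoffel y β β γ v = _ at h
  rw [h]
  exact pd_sqrt_det (differentiableAt_gram hy hv) (det_gram_pos hy hv) γ

/-- The transformation law of the Christoffel symbols under a change of charts. -/
theorem christoffelVec_gram_transform {y y' : OpenPartialHomeomorph M (Coord d)}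
    (hy : y ∈ IsManifold.maximalAtlas (𝓡 d) ∞ M) (hy' : y' ∈ IsManifold.maximalAtlas (𝓡 d) ∞ M)
    {v : Coord d} (hv : v ∈ y.target) (hv' : y.symm v ∈ y'.source) (a b : Coord d) :
    fderiv ℝ (y' ∘ y.symm) v (christoffelVec (gram y) v a b) =
      fderiv ℝ (fderiv ℝ (y' ∘ y.symm)) v a b +
      christoffelVec (gram y') ((y' ∘ y.symm) v) (fderiv ℝ (y' ∘ y.symm) v a)
        (fderiv ℝ (y' ∘ y.symm) v b) := by
  have hw : (y' ∘ y.symm) v ∈ y'.target := y'.map_source hv'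
  refine christoffelVec_transform
    ((contDiffAt_transition hy hy' hv hv').of_le (by norm_cast))
    (differentiableAt_gram hy hv) (differentiableAt_gram hy' hw) (det_gram_pos hy hv).ne'.isUnit
    (det_gram_pos hy' hw).ne'.isUnit (gram_transpose y')
    (fderiv_transition_bijective hy hy' hv hv').2 ?_ a b
  have hopen : IsOpen (y.target ∩ y.symm ⁻¹' y'.source) :=
    y.symm.isOpen_inter_preimage y'.open_source
  filter_upwards [hopen.mem_nhds ⟨hv, hv'⟩] with w ⟨hw1, hw2⟩ a b
  rw [bil_gram hy hw1, ← dchart_comp_dsymm hy hy' hw1 hw2, ← dchart_comp_dsymm hy hy' hw1 hw2]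
  exact (bil_gram_dchart hy' hw2 _ _).symm

end Metric

/-! ### The map and sections along it in coordinates; the covariant derivative is independent of the
chart. -/

section Maps

set_option linter.unusedSectionVars false

variable {d : ℕ} {M₁ M₂ : Type*}
  [TopologicalSpace M₁] [ChartedSpace (Coord d) M₁] [IsManifold (𝓡 d) ∞ M₁]
  [TopologicalSpace M₂] [ChartedSpace (Coord d) M₂] [IsManifold (𝓡 d) ∞ M₂]
  {f : M₁ → M₂} {x : OpenPartialHomeomorph M₁ (Coord d)} {y : OpenPartialHomeomorph M₂ (Coord d)}

theorem isOpen_coordDomain (hf : Continuous f) (x : OpenPartialHomeomorph M₁ (Coord d))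
    (y : OpenPartialHomeomorph M₂ (Coord d)) : IsOpen (coordDomain f x y) :=
  x.symm.isOpen_inter_preimage (y.open_source.preimage hf)

theorem contDiffAt_coordRep (hf : ContMDiff (𝓡 d) (𝓡 d) 2 f)
    (hx : x ∈ IsManifold.maximalAtlas (𝓡 d) ∞ M₁) (hy : y ∈ IsManifold.maximalAtlas (𝓡 d) ∞ M₂)
    {u : Coord d} (hu : u ∈ coordDomain f x y) : ContDiffAt ℝ 2 (coordRep f x y) u := by
  have h2 : (2 : WithTop ℕ∞) ≤ ∞ := by norm_cast
  have h1 := (hf (x.symm u)).comp u ((contMDiffAt_symm_of_mem_maximalAtlas hx hu.1).of_le h2)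
  exact (((contMDiffAt_of_mem_maximalAtlas hy hu.2).of_le h2).comp u h1).contDiffAt

theorem divCof_eq_zero (hf : ContMDiff (𝓡 d) (𝓡 d) 2 f)
    (hx : x ∈ IsManifold.maximalAtlas (𝓡 d) ∞ M₁) (hy : y ∈ IsManifold.maximalAtlas (𝓡 d) ∞ M₂)
    {u : Coord d} (hu : u ∈ coordDomain f x y) (γ : Fin d) : divCof f x y γ u = 0 :=
  sum_pd_adjugate_jacobian (contDiffAt_coordRep hf hx hy hu) γ

theorem jac_apply_eq_fderiv (hf : ContMDiff (𝓡 d) (𝓡 d) 2 f)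
    (hx : x ∈ IsManifold.maximalAtlas (𝓡 d) ∞ M₁) (hy : y ∈ IsManifold.maximalAtlas (𝓡 d) ∞ M₂)
    {u : Coord d} (hu : u ∈ coordDomain f x y) (α i : Fin d) :
    jac f x y u α i = fderiv ℝ (coordRep f x y) u (stdVec i) α := by
  have h := (EuclideanSpace.proj (𝕜 := ℝ) α : Coord d →L[ℝ] ℝ).hasFDerivAt.comp u
    ((contDiffAt_coordRep hf hx hy hu).differentiableAt (by simp)).hasFDerivAt
  exact congrArg (fun L => L (stdVec i)) h.fderiv

theorem mfderiv_coordRep (hf : ContMDiff (𝓡 d) (𝓡 d) 2 f)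
    (hx : x ∈ IsManifold.maximalAtlas (𝓡 d) ∞ M₁) (hy : y ∈ IsManifold.maximalAtlas (𝓡 d) ∞ M₂)
    {u : Coord d} (hu : u ∈ coordDomain f x y) (a : Coord d) :
    dchart y (f (x.symm u)) (mfderiv (𝓡 d) (𝓡 d) f (x.symm u) (dsymm x u a)) =
      fderiv ℝ (coordRep f x y) u a := by
  have hx' := (mdifferentiable_of_mem_maximalAtlas hx).mdifferentiableAt_symm hu.1
  have hy' := (mdifferentiable_of_mem_maximalAtlas hy).mdifferentiableAt hu.2
  have hf' : MDifferentiableAt (𝓡 d) (𝓡 d) f (x.symm u) := (hf _).mdifferentiableAt (by simp)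
  have h1 := mfderiv_comp u hf' hx'
  have h2 := mfderiv_comp (g := y) u hy' (hf'.comp u hx')
  rw [h1] at h2
  rw [← mfderiv_eq_fderiv]
  exact (congrArg (fun L => L a) h2).symm

theorem mvfderiv_dsymm {g : M₁ → ℝ} (hx : x ∈ IsManifold.maximalAtlas (𝓡 d) ∞ M₁) {u : Coord d}
    (hu : u ∈ x.target) (hg : MDifferentiableAt (𝓡 d) 𝓘(ℝ, ℝ) g (x.symm u)) (a : Coord d) :
    mvfderiv (𝓡 d) g (x.symm u) (dsymm x u a) = fderiv ℝ (fun w => g (x.symm w)) u a := by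
  have h := mfderiv_comp u hg ((mdifferentiable_of_mem_maximalAtlas hx).mdifferentiableAt_symm hu)
  rw [← mfderiv_eq_fderiv]
  exact (congrArg (fun L => L a) h).symm

/-- A vector field along `f` in coordinates. -/
def fieldRep (f : M₁ → M₂) (x : OpenPartialHomeomorph M₁ (Coord d))
    (y : OpenPartialHomeomorph M₂ (Coord d)) (ξ : ∀ p, TangentSpace (𝓡 d) (f p)) (u : Coord d) :
    Coord d :=
  dchart y (f (x.symm u)) (ξ (x.symm u))

/-- The map is the fibre component of `ξ` followed by the tangent map of `y`, hence `C¹`. -/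
theorem contMDiffAt_dchart {ξ : ∀ p, TangentSpace (𝓡 d) (f p)} (hξ : IsC1Along f ξ)
    (hy : y ∈ IsManifold.maximalAtlas (𝓡 d) ∞ M₂) {p : M₁} (hp : f p ∈ y.source) :
    ContMDiffAt (𝓡 d) 𝓘(ℝ, Coord d) 1 (fun q => dchart y (f q) (ξ q)) p := by
  have h1 := (contMDiffOn_of_mem_maximalAtlas hy).contMDiffOn_tangentMapWithin
    (m := 1) (by norm_cast) y.open_source.uniqueMDiffOn
  have hopen : IsOpen ((fun p => (⟨f p, ξ p⟩ : TangentBundle (𝓡 d) M₂)) ⁻¹'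
      (Bundle.TotalSpace.proj ⁻¹' y.source)) :=
    (y.open_source.preimage (FiberBundle.continuous_proj (Coord d) _)).preimage hξ.continuous
  have h2 := (h1.contMDiffAt ((y.open_source.preimage
    (FiberBundle.continuous_proj (Coord d) _)).mem_nhds
      (show (⟨f p, ξ p⟩ : TangentBundle (𝓡 d) M₂) ∈ _ from hp))).comp p (hξ p)
  have h3 := (contMDiff_snd_tangentBundle_modelSpace (Coord d) (𝓡 d) (n := 1)).contMDiffAt.comp p h2
  refine h3.congr_of_eventuallyEq ?_
  filter_upwards [hopen.mem_nhds hp] with q hq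
  have h4 : mfderivWithin (𝓡 d) (𝓡 d) y y.source (f q) = mfderiv (𝓡 d) (𝓡 d) y (f q) :=
    mfderivWithin_of_isOpen y.open_source hq
  exact (congrArg (fun L => L (ξ q)) h4).symm

theorem contDiffAt_fieldRep {ξ : ∀ p, TangentSpace (𝓡 d) (f p)} (hξ : IsC1Along f ξ)
    (hx : x ∈ IsManifold.maximalAtlas (𝓡 d) ∞ M₁) (hy : y ∈ IsManifold.maximalAtlas (𝓡 d) ∞ M₂)
    {u : Coord d} (hu : u ∈ coordDomain f x y) : ContDiffAt ℝ 1 (fieldRep f x y ξ) u :=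
  ((contMDiffAt_dchart hξ hy hu.2).comp u
    ((contMDiffAt_symm_of_mem_maximalAtlas hx hu.1).of_le (by norm_cast))).contDiffAt

variable [RiemannianBundle (fun p : M₂ => TangentSpace (𝓡 d) p)]

/-- The covariant derivative along `f` in coordinates. -/
theorem dchart_covDerivIn (hf : ContMDiff (𝓡 d) (𝓡 d) 2 f)
    {ξ : ∀ p, TangentSpace (𝓡 d) (f p)} (hξ : IsC1Along f ξ)
    (hx : x ∈ IsManifold.maximalAtlas (𝓡 d) ∞ M₁) (hy : y ∈ IsManifold.maximalAtlas (𝓡 d) ∞ M₂)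
    {u : Coord d} (hu : u ∈ coordDomain f x y) (a : Coord d) :
    dchart y (f (x.symm u)) (covDerivIn y f ξ (x.symm u) (dsymm x u a)) =
      fderiv ℝ (fieldRep f x y ξ) u a + christoffelVec (gram y) (coordRep f x y u)
        (fderiv ℝ (coordRep f x y) u a) (fieldRep f x y ξ u) := by
  have hX := contDiffAt_fieldRep hξ hx hy hu
  have hg (β : Fin d) : mvfderiv (𝓡 d) (fun q => dchart y (f q) (ξ q) β) (x.symm u) (dsymm x u a) =
      fderiv ℝ (fieldRep f x y ξ) u a β := by
    have h1 : MDifferentiableAt (𝓡 d) 𝓘(ℝ, ℝ) (fun q => dchart y (f q) (ξ q) β) (x.symm u) :=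
      ((EuclideanSpace.proj (𝕜 := ℝ) β : Coord d →L[ℝ] ℝ).contMDiff.contMDiffAt.comp _
        (contMDiffAt_dchart hξ hy hu.2)).mdifferentiableAt (by simp)
    rw [mvfderiv_dsymm hx hu.1 h1]
    have h := (EuclideanSpace.proj (𝕜 := ℝ) β : Coord d →L[ℝ] ℝ).hasFDerivAt.comp u
      (hX.differentiableAt (by simp)).hasFDerivAt
    exact congrArg (fun L => L a) h.fderiv
  ext β
  simp only [covDerivIn, LinearMap.sum_apply, LinearMap.smulRight_apply, map_sum, map_smul,
    dchart_frame hy hu.2, LinearMap.add_apply, LinearMap.smul_apply, LinearMap.comp_apply,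
    ContinuousLinearMap.coe_coe, hg, comp_eq_dchart, mfderiv_coordRep hf hx hy hu]
  simp only [WithLp.ofLp_sum, WithLp.ofLp_smul, Finset.sum_apply, Pi.smul_apply,
    stdVec_apply, smul_eq_mul, mul_ite, mul_one, mul_zero, Finset.sum_ite_eq, Finset.mem_univ,
    if_true, christoffelVec, WithLp.ofLp_add, Pi.add_apply]
  congr 1
  refine Finset.sum_congr rfl fun γ _ => Finset.sum_congr rfl fun δ _ => ?_
  change christoffelOf (gram y) β γ δ (coordRep f x y u) * fieldRep f x y ξ u δ * _ = _
  ring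

variable [IsContMDiffRiemannianBundle (𝓡 d) ∞ (Coord d) (fun p : M₂ => TangentSpace (𝓡 d) p)]

/-- The covariant derivative along `f` does not depend on the chart. -/
theorem covDerivIn_eq_covDerivIn (hf : ContMDiff (𝓡 d) (𝓡 d) 2 f)
    {ξ : ∀ p, TangentSpace (𝓡 d) (f p)} (hξ : IsC1Along f ξ)
    {y y' : OpenPartialHomeomorph M₂ (Coord d)}
    (hy : y ∈ IsManifold.maximalAtlas (𝓡 d) ∞ M₂) (hy' : y' ∈ IsManifold.maximalAtlas (𝓡 d) ∞ M₂)
    {p : M₁} (hp : f p ∈ y.source) (hp' : f p ∈ y'.source) :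
    covDerivIn y' f ξ p = covDerivIn y f ξ p := by
  -- An auxiliary chart of `M₁`, so that both derivatives can be compared in coordinates.
  set x := chartAt (Coord d) p with hx_def
  have hx : x ∈ IsManifold.maximalAtlas (𝓡 d) ∞ M₁ := IsManifold.chart_mem_maximalAtlas p
  obtain ⟨u, hu, hpu⟩ : ∃ u ∈ x.target, p = x.symm u :=
    ⟨x p, mem_chart_target _ p, (x.left_inv (mem_chart_source _ p)).symm⟩
  clear_value x
  subst hpu
  have huy : u ∈ coordDomain f x y := ⟨hu, hp⟩
  have huy' : u ∈ coordDomain f x y' := ⟨hu, hp'⟩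
  have hsurj : Function.Surjective (dsymm x u) :=
    ((mdifferentiable_of_mem_maximalAtlas hx).symm.mfderiv_bijective hu).2
  refine LinearMap.ext fun z => ?_
  obtain ⟨a, rfl⟩ := hsurj z
  apply dchart_injective hy' hp'
  rw [dchart_eq_fderiv_transition hy hy' hp hp' (covDerivIn y f ξ (x.symm u) (dsymm x u a)),
    dchart_covDerivIn hf hξ hx hy huy, dchart_covDerivIn hf hξ hx hy' huy']
  set ψ := y' ∘ y.symm
  set F := coordRep f x y
  set X := fieldRep f x y ξ
  have hv : F u ∈ y.target := y.map_source hp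
  have hsv : y.symm (F u) = f (x.symm u) := y.left_inv hp
  have hv' : y.symm (F u) ∈ y'.source := by rw [hsv]; exact hp'
  have hψ : ContDiffAt ℝ ∞ ψ (F u) := contDiffAt_transition hy hy' hv hv'
  have hψ1 : DifferentiableAt ℝ ψ (F u) := hψ.differentiableAt (by simp)
  have hψ2 : DifferentiableAt ℝ (fderiv ℝ ψ) (F u) :=
    (hψ.fderiv_right (m := 1) (by norm_cast)).differentiableAt (by simp)
  have hF : DifferentiableAt ℝ F u := (contDiffAt_coordRep hf hx hy huy).differentiableAt (by simp)
  have hX : DifferentiableAt ℝ X u := (contDiffAt_fieldRep hξ hx hy huy).differentiableAt (by simp)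
  have hev : ∀ᶠ w in nhds u, w ∈ coordDomain f x y ∧ w ∈ coordDomain f x y' :=
    Filter.Eventually.and ((isOpen_coordDomain hf.continuous x y).mem_nhds huy)
      ((isOpen_coordDomain hf.continuous x y').mem_nhds huy')
  have hF' : coordRep f x y' =ᶠ[nhds u] ψ ∘ F := by
    filter_upwards [hev] with w hw
    simp [ψ, F, coordRep, y.left_inv hw.1.2]
  have hX' : fieldRep f x y' ξ =ᶠ[nhds u] fun w => fderiv ℝ ψ (F w) (X w) := by
    filter_upwards [hev] with w hw
    exact dchart_eq_fderiv_transition hy hy' hw.1.2 hw.2.2 _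
  have hDF' : fderiv ℝ (coordRep f x y') u a = fderiv ℝ ψ (F u) (fderiv ℝ F u a) := by
    rw [hF'.fderiv_eq, fderiv_comp u hψ1 hF]
    rfl
  -- The components change by `Dψ`, whose own derivative contributes `D²ψ`; this is the same term as
  -- in the transformation law of the Christoffel symbols.
  have hDX' : fderiv ℝ (fieldRep f x y' ξ) u a =
      fderiv ℝ ψ (F u) (fderiv ℝ X u a) + fderiv ℝ (fderiv ℝ ψ) (F u) (fderiv ℝ F u a) (X u) := by
    have h := ((hψ2.hasFDerivAt.comp u hF.hasFDerivAt).clm_apply hX.hasFDerivAt).fderiv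
    rw [hX'.fderiv_eq]
    exact congrArg (fun L => L a) h
  rw [hDX', hDF', hX'.self_of_nhds, hF'.self_of_nhds]
  change _ = fderiv ℝ ψ (F u) _
  rw [map_add, christoffelVec_gram_transform hy hy' hv hv', add_assoc]
  rfl

end Maps

/-! ### Pointwise identities for the cofactor and the integrand of the weak form. -/

section Pointwise

set_option linter.unusedSectionVars false

variable {d : ℕ} {M₁ M₂ : Type*}
  [TopologicalSpace M₁] [ChartedSpace (Coord d) M₁] [IsManifold (𝓡 d) ∞ M₁]
  [TopologicalSpace M₂] [ChartedSpace (Coord d) M₂] [IsManifold (𝓡 d) ∞ M₂]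
  [RiemannianBundle (fun p : M₂ => TangentSpace (𝓡 d) p)]
  [IsContMDiffRiemannianBundle (𝓡 d) ∞ (Coord d) (fun p : M₂ => TangentSpace (𝓡 d) p)]
  {f : M₁ → M₂} {x : OpenPartialHomeomorph M₁ (Coord d)} {y : OpenPartialHomeomorph M₂ (Coord d)}

theorem coordRep_mem_target {u : Coord d} (hu : u ∈ coordDomain f x y) :
    coordRep f x y u ∈ y.target := y.map_source hu.2

theorem pullDensity_pos (hy : y ∈ IsManifold.maximalAtlas (𝓡 d) ∞ M₂) {u : Coord d}
    (hu : u ∈ coordDomain f x y) : 0 < pullDensity f x y u :=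
  density_pos hy (coordRep_mem_target hu)

theorem contDiffAt_pullDensity (hf : ContMDiff (𝓡 d) (𝓡 d) 2 f)
    (hx : x ∈ IsManifold.maximalAtlas (𝓡 d) ∞ M₁) (hy : y ∈ IsManifold.maximalAtlas (𝓡 d) ∞ M₂)
    {u : Coord d} (hu : u ∈ coordDomain f x y) : ContDiffAt ℝ 2 (pullDensity f x y) u :=
  ((contDiffAt_density hy (coordRep_mem_target hu)).of_le (by norm_cast)).comp u
    (contDiffAt_coordRep hf hx hy hu)

theorem sum_jac_mul_adjugate (A : Matrix (Fin d) (Fin d) ℝ) (β γ : Fin d) :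
    ∑ j, A β j * A.adjugate j γ = if β = γ then A.det else 0 := by
  have h := congrFun (congrFun (Matrix.mul_adjugate A) β) γ
  simpa [Matrix.mul_apply, Matrix.one_apply] using h

theorem pd_pullDensity (hf : ContMDiff (𝓡 d) (𝓡 d) 2 f)
    (hx : x ∈ IsManifold.maximalAtlas (𝓡 d) ∞ M₁) (hy : y ∈ IsManifold.maximalAtlas (𝓡 d) ∞ M₂)
    {u : Coord d} (hu : u ∈ coordDomain f x y) (j : Fin d) :
    pd j (pullDensity f x y) u =
      ∑ β, jac f x y u β j * (pullDensity f x y u * pullTraceChristoffel f x y β u) := by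
  have h := fderiv_comp u ((contDiffAt_density hy (coordRep_mem_target hu)).differentiableAt
    (by simp)) ((contDiffAt_coordRep hf hx hy hu).differentiableAt (by simp))
  have h2 : pd j (pullDensity f x y) u =
      fderiv ℝ (density y) (coordRep f x y u) (fderiv ℝ (coordRep f x y) u (stdVec j)) :=
    congrArg (fun L => L (stdVec j)) h
  rw [h2, fderiv_eq_sum_pd]
  refine Finset.sum_congr rfl fun β _ => ?_
  rw [jac_apply_eq_fderiv hf hx hy hu, pd_density hy (coordRep_mem_target hu)]
  rfl

theorem differentiableAt_adjugate_jac (hf : ContMDiff (𝓡 d) (𝓡 d) 2 f)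
    (hx : x ∈ IsManifold.maximalAtlas (𝓡 d) ∞ M₁) (hy : y ∈ IsManifold.maximalAtlas (𝓡 d) ∞ M₂)
    {u : Coord d} (hu : u ∈ coordDomain f x y) (j γ : Fin d) :
    DifferentiableAt ℝ (fun w => (jac f x y w).adjugate j γ) u :=
  differentiableAt_adjugate (fun α i =>
    (contDiffAt_jacobian (contDiffAt_coordRep hf hx hy hu) α i).differentiableAt (by simp)) j γ

/-- Product rule. Where the derivative falls on the density, `pd_pullDensity` produces a factor `J β
j` that contracts with `adj J` to `det J`, leaving only the index `β = γ`. -/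
theorem divDensityCof_eq_add (hf : ContMDiff (𝓡 d) (𝓡 d) 2 f)
    (hx : x ∈ IsManifold.maximalAtlas (𝓡 d) ∞ M₁) (hy : y ∈ IsManifold.maximalAtlas (𝓡 d) ∞ M₂)
    {u : Coord d} (hu : u ∈ coordDomain f x y) (γ : Fin d) :
    divDensityCof f x y γ u = pullDensity f x y u * divCof f x y γ u +
      pullDensity f x y u * (pullTraceChristoffel f x y γ u * (jac f x y u).det) := by
  have h1 (j : Fin d) : pd j (fun w => (matCof (jac f x y w))ᵀ j γ * pullDensity f x y w) u =
      pullDensity f x y u * pd j (fun w => (matCof (jac f x y w))ᵀ j γ) u +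
      (jac f x y u).adjugate j γ * pd j (pullDensity f x y) u := by
    have h := (differentiableAt_adjugate_jac hf hx hy hu j γ).hasFDerivAt.mul
      ((contDiffAt_pullDensity hf hx hy hu).differentiableAt (by simp)).hasFDerivAt
    refine (congrArg (fun L => L (stdVec j)) h.fderiv).trans ?_
    simp only [add_apply, smul_apply, smul_eq_mul]
    exact add_comm _ _
  have h2 : ∑ j, (jac f x y u).adjugate j γ * pd j (pullDensity f x y) u =
      pullDensity f x y u * (pullTraceChristoffel f x y γ u * (jac f x y u).det) := by
    simp only [pd_pullDensity hf hx hy hu, Finset.mul_sum]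
    rw [Finset.sum_comm]
    have h3 (β : Fin d) : ∑ j, (jac f x y u).adjugate j γ * (jac f x y u β j *
        (pullDensity f x y u * pullTraceChristoffel f x y β u)) =
        (if β = γ then (jac f x y u).det else 0) *
          (pullDensity f x y u * pullTraceChristoffel f x y β u) := by
      rw [← sum_jac_mul_adjugate, Finset.sum_mul]
      exact Finset.sum_congr rfl fun j _ => by ring
    simp only [h3, ite_mul, zero_mul, Finset.sum_ite_eq', Finset.mem_univ, if_true]
    ring
  simp only [divDensityCof, divCof, h1, Finset.sum_add_distrib, h2, Finset.mul_sum]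

/-- The connection terms cancel identically; the vanishing of `divCof` plays no part here. -/
theorem coordPiola_eq_neg_divCof (hf : ContMDiff (𝓡 d) (𝓡 d) 2 f)
    (hx : x ∈ IsManifold.maximalAtlas (𝓡 d) ∞ M₁) (hy : y ∈ IsManifold.maximalAtlas (𝓡 d) ∞ M₂)
    {u : Coord d} (hu : u ∈ coordDomain f x y) (γ : Fin d) :
    coordPiola f x y γ u = -divCof f x y γ u := by
  have h := (pullDensity_pos hy hu).ne'
  rw [coordPiola, divDensityCof_eq_add hf hx hy hu]
  field_simp
  ring

theorem divDensityCof_eq (hf : ContMDiff (𝓡 d) (𝓡 d) 2 f)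
    (hx : x ∈ IsManifold.maximalAtlas (𝓡 d) ∞ M₁) (hy : y ∈ IsManifold.maximalAtlas (𝓡 d) ∞ M₂)
    {u : Coord d} (hu : u ∈ coordDomain f x y) (γ : Fin d) :
    divDensityCof f x y γ u =
      pullDensity f x y u * (pullTraceChristoffel f x y γ u * (jac f x y u).det) := by
  rw [divDensityCof_eq_add hf hx hy hu, divCof_eq_zero hf hx hy hu, mul_zero, zero_add]

theorem pd_comp_eq {ξ : ∀ p, TangentSpace (𝓡 d) (f p)} (hξ : IsC1Along f ξ)
    (hx : x ∈ IsManifold.maximalAtlas (𝓡 d) ∞ M₁) (hy : y ∈ IsManifold.maximalAtlas (𝓡 d) ∞ M₂)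
    {u : Coord d} (hu : u ∈ coordDomain f x y) (j γ : Fin d) :
    pd j (fun w => comp y (f (x.symm w)) γ (ξ (x.symm w))) u =
      fderiv ℝ (fieldRep f x y ξ) u (stdVec j) γ := by
  have h := (EuclideanSpace.proj (𝕜 := ℝ) γ : Coord d →L[ℝ] ℝ).hasFDerivAt.comp u
    ((contDiffAt_fieldRep hξ hx hy hu).differentiableAt (by simp)).hasFDerivAt
  exact congrArg (fun L => L (stdVec j)) h.fderiv

variable [RiemannianBundle (fun p : M₁ => TangentSpace (𝓡 d) p)]

/-- The integrand of the weak form of the Piola identity in positive coordinates. -/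
theorem homInner_cofDiff_covDeriv [NeZero d] {o₁ : ManifoldOrientation d M₁}
    {o₂ : ManifoldOrientation d M₂} (hf : ContMDiff (𝓡 d) (𝓡 d) 2 f)
    (hx : x ∈ IsManifold.maximalAtlas (𝓡 d) ∞ M₁) (hy : y ∈ IsManifold.maximalAtlas (𝓡 d) ∞ M₂)
    (hxpos : IsPositiveChart o₁.orient x) (hypos : IsPositiveChart o₂.orient y)
    {ξ : ∀ p, TangentSpace (𝓡 d) (f p)} (hξ : IsC1Along f ξ) {u : Coord d}
    (hu : u ∈ coordDomain f x y) :
    homInner (cofDiff o₁ o₂ f (x.symm u)) (covDeriv f ξ (x.symm u)) * density x u =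
      ∑ γ, ((∑ j, (matCof (jac f x y u))ᵀ j γ *
          pd j (fun w => comp y (f (x.symm w)) γ (ξ (x.symm w))) u) +
        pullTraceChristoffel f x y γ u * (jac f x y u).det *
          comp y (f (x.symm u)) γ (ξ (x.symm u))) * pullDensity f x y u := by
  have hp := x.map_target hu.1
  -- `covDeriv` is computed in the preferred chart at `f p`; chart independence replaces it by `y`.
  have hcov : covDeriv f ξ (x.symm u) = covDerivIn y f ξ (x.symm u) :=
    covDerivIn_eq_covDerivIn hf hξ hy (IsManifold.chart_mem_maximalAtlas _) hu.2
      (mem_chart_source _ _)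
  have hkey := homInner_Cof_mul_volumeForm (o₁.orient (x.symm u)) (o₂.orient (f (x.symm u)))
    (frameBasis hx hp) (frameBasis hy hu.2) (mfderiv (𝓡 d) (𝓡 d) f (x.symm u)).toLinearMap
    (covDerivIn y f ξ (x.symm u))
  rw [coe_frameBasis, coe_frameBasis, volumeForm_frame_of_isPositiveChart hxpos hp,
    volumeForm_frame_of_isPositiveChart hypos hu.2, x.right_inv hu.1] at hkey
  rw [hcov]
  refine hkey.trans ?_
  rw [← Finset.sum_mul]
  congr 1
  have hA : LinearMap.toMatrix (frameBasis hx hp) (frameBasis hy hu.2)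
      (mfderiv (𝓡 d) (𝓡 d) f (x.symm u)).toLinearMap = jac f x y u := by
    ext α i
    rw [LinearMap.toMatrix_apply, frameBasis_repr, coe_frameBasis, frame_symm hx hu.1,
      jac_apply_eq_fderiv hf hx hy hu, ← mfderiv_coordRep hf hx hy hu]
    rfl
  have hB (α i : Fin d) : LinearMap.toMatrix (frameBasis hx hp) (frameBasis hy hu.2)
      (covDerivIn y f ξ (x.symm u)) α i = fderiv ℝ (fieldRep f x y ξ) u (stdVec i) α +
        ∑ β, ∑ δ, christoffel y α β δ (coordRep f x y u) *
          (jac f x y u β i * fieldRep f x y ξ u δ) := by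
    rw [LinearMap.toMatrix_apply, frameBasis_repr, coe_frameBasis, frame_symm hx hu.1,
      dchart_covDerivIn hf hξ hx hy hu]
    simp only [jac_apply_eq_fderiv hf hx hy hu]
    rfl
  rw [hA, Matrix.trace]
  simp only [Matrix.diag_apply, Matrix.mul_apply, hB, pd_comp_eq hξ hx hy hu, mul_add,
    Finset.sum_add_distrib]
  congr 1
  · rw [Finset.sum_comm]
    rfl
  · rw [Finset.sum_comm]
    -- Contracting `adj J` with the factor `J β j` of the connection term forces `β = γ`, so only
    -- `Γ^γ_{γδ} det J` remains.
    have h3 (γ : Fin d) : ∑ j, (jac f x y u).adjugate j γ *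
        (∑ β, ∑ δ, christoffel y γ β δ (coordRep f x y u) *
          (jac f x y u β j * fieldRep f x y ξ u δ)) =
        ∑ δ, christoffel y γ γ δ (coordRep f x y u) * (jac f x y u).det * fieldRep f x y ξ u δ := by
      simp only [Finset.mul_sum]
      rw [Finset.sum_comm_cycle]
      refine Finset.sum_congr rfl fun δ _ => ?_
      rw [Finset.sum_comm]
      have h4 (β : Fin d) : ∑ j, (jac f x y u).adjugate j γ *
          (christoffel y γ β δ (coordRep f x y u) *
            (jac f x y u β j * fieldRep f x y ξ u δ)) = (if β = γ then (jac f x y u).det else 0) *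
          (christoffel y γ β δ (coordRep f x y u) * fieldRep f x y ξ u δ) := by
        rw [← sum_jac_mul_adjugate, Finset.sum_mul]
        exact Finset.sum_congr rfl fun j _ => by ring
      simp only [h4, ite_mul, zero_mul, Finset.sum_ite_eq', Finset.mem_univ, if_true]
      ring
    simp only [h3]
    rw [Finset.sum_comm]
    simp only [pullTraceChristoffel, Finset.sum_mul]
    rfl

end Pointwise

/-! ### The Riemannian volume measure in charts. -/

section Volume

set_option linter.unusedSectionVars false

open MeasureTheory

variable {d : ℕ} {M : Type*} [TopologicalSpace M] [ChartedSpace (Coord d) M]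
  [IsManifold (𝓡 d) ∞ M] [RiemannianBundle (fun p : M => TangentSpace (𝓡 d) p)]

/-- The change of the volume density under a change of charts. -/
theorem density_transition {x y : OpenPartialHomeomorph M (Coord d)}
    (hx : x ∈ IsManifold.maximalAtlas (𝓡 d) ∞ M) (hy : y ∈ IsManifold.maximalAtlas (𝓡 d) ∞ M)
    {v : Coord d} (hv : v ∈ y.target) (hv' : y.symm v ∈ x.source) :
    density y v = |(fderiv ℝ (x ∘ y.symm) v).det| * density x (x (y.symm v)) := by
  set e := (EuclideanSpace.basisFun (Fin d) ℝ).toBasis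
  set P := LinearMap.toMatrix e e (fderiv ℝ (x ∘ y.symm) v).toLinearMap with hP
  have hPa (α i : Fin d) : P α i = fderiv ℝ (x ∘ y.symm) v (stdVec i) α := by
    simp [hP, e, LinearMap.toMatrix_apply, stdVec]
  -- The metric transforms by congruence, so its determinant gains the square of the Jacobian
  -- determinant.
  have hG : gram y v = Pᵀ * gram x (x (y.symm v)) * P := by
    ext α β
    have h1 : gram y v α β = bil (gram y v) (stdVec α) (stdVec β) := by
      simp [bil_apply, stdVec_apply]
    rw [h1, bil_gram hy hv, ← bil_gram_dchart hx hv', dchart_comp_dsymm hy hx hv hv',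
      dchart_comp_dsymm hy hx hv hv', bil_eq_dotProduct, Matrix.mul_assoc, Matrix.mul_apply]
    simp only [dotProduct, Matrix.transpose_apply, hPa, Matrix.mulVec, Matrix.mul_apply]
  have hdet : P.det = (fderiv ℝ (x ∘ y.symm) v).det := LinearMap.det_toMatrix e _
  rw [density, density, hG, Matrix.det_mul, Matrix.det_mul, Matrix.det_transpose, ← hdet,
    show P.det * (gram x (x (y.symm v))).det * P.det =
      P.det ^ 2 * (gram x (x (y.symm v))).det by ring,
    Real.sqrt_mul (sq_nonneg _), Real.sqrt_sq_eq_abs]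

variable [IsContMDiffRiemannianBundle (𝓡 d) ∞ (Coord d) (fun p : M => TangentSpace (𝓡 d) p)]

theorem continuousOn_density {x : OpenPartialHomeomorph M (Coord d)}
    (hx : x ∈ IsManifold.maximalAtlas (𝓡 d) ∞ M) : ContinuousOn (density x) x.target :=
  fun _ hu => (contDiffAt_density hx hu).continuousAt.continuousWithinAt

variable [MeasurableSpace M] [BorelSpace M]

theorem measurableSet_inter_preimage_of_continuousOn {X Y : Type*} [TopologicalSpace X]
    [MeasurableSpace X] [OpensMeasurableSpace X] [TopologicalSpace Y] [MeasurableSpace Y]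
    [BorelSpace Y] {g : X → Y} {T : Set X} (hT : MeasurableSet T) (hg : ContinuousOn g T)
    {s : Set Y} (hs : MeasurableSet s) : MeasurableSet (T ∩ g ⁻¹' s) := by
  have h : MeasurableSet (T.domRestrict g ⁻¹' s) := hg.domRestrict.measurable hs
  convert hT.subtype_image h using 1
  ext z
  simp [Set.domRestrict, and_comm]

/-- Off `x.target` nothing is known about `x.symm`, but the measure is carried by the target. -/
theorem aemeasurable_symm (x : OpenPartialHomeomorph M (Coord d)) (φ : Coord d → ENNReal) :
    AEMeasurable x.symm (((volume : Measure (Coord d)).restrict x.target).withDensity φ) :=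
  (x.continuousOn_symm.aemeasurable x.open_target.measurableSet).mono_ac
    (withDensity_absolutelyContinuous _ _)

theorem chartVolume_apply (x : OpenPartialHomeomorph M (Coord d)) {s : Set M}
    (hs : MeasurableSet s) : chartVolume x s =
      ∫⁻ u in x.target ∩ x.symm ⁻¹' s, ENNReal.ofReal (density x u) := by
  rw [chartVolume, Measure.map_apply_of_aemeasurable (aemeasurable_symm x _) hs,
    withDensity_apply', Measure.restrict_restrict' x.open_target.measurableSet, Set.inter_comm]

/-- The chart volumes agree on overlaps. -/
theorem chartVolume_apply_eq {x y : OpenPartialHomeomorph M (Coord d)}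
    (hx : x ∈ IsManifold.maximalAtlas (𝓡 d) ∞ M) (hy : y ∈ IsManifold.maximalAtlas (𝓡 d) ∞ M)
    {s : Set M} (hs : MeasurableSet s) (hsx : s ⊆ x.source) (hsy : s ⊆ y.source) :
    chartVolume y s = chartVolume x s := by
  rw [chartVolume_apply y hs, chartVolume_apply x hs]
  have hA : MeasurableSet (y.target ∩ y.symm ⁻¹' s) :=
    measurableSet_inter_preimage_of_continuousOn y.open_target.measurableSet y.continuousOn_symm hs
  have himage : x.target ∩ x.symm ⁻¹' s = (x ∘ y.symm) '' (y.target ∩ y.symm ⁻¹' s) := by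
    ext u
    constructor
    · rintro ⟨hu, hus⟩
      refine ⟨y (x.symm u), ⟨y.map_source (hsy hus), ?_⟩, ?_⟩
      · simpa [y.left_inv (hsy hus)] using hus
      · simp [y.left_inv (hsy hus), x.right_inv hu]
    · rintro ⟨v, ⟨hv, hvs⟩, rfl⟩
      refine ⟨x.map_source (hsx hvs), ?_⟩
      simpa [x.left_inv (hsx hvs)] using hvs
  have hinj : Set.InjOn (x ∘ y.symm) (y.target ∩ y.symm ⁻¹' s) := fun v hv w hw h =>
    y.symm.injOn hv.1 hw.1 (x.injOn (hsx hv.2) (hsx hw.2) h)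
  have hder : ∀ v ∈ y.target ∩ y.symm ⁻¹' s, HasFDerivWithinAt (x ∘ y.symm)
      (fderiv ℝ (x ∘ y.symm) v) (y.target ∩ y.symm ⁻¹' s) v := fun v hv =>
    ((contDiffAt_transition hy hx hv.1 (hsx hv.2)).differentiableAt
      (by simp)).hasFDerivAt.hasFDerivWithinAt
  -- Change of variables along the transition map: its Jacobian determinant is the one in
  -- `density_transition`.
  rw [himage, lintegral_image_eq_lintegral_abs_det_fderiv_mul volume hA hder hinj]
  refine setLIntegral_congr_fun hA fun v hv => ?_
  rw [← ENNReal.ofReal_mul (abs_nonneg _), density_transition hx hy hv.1 (hsx hv.2)]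
  rfl

theorem chartVolume_compl_source (x : OpenPartialHomeomorph M (Coord d)) :
    chartVolume x x.sourceᶜ = 0 := by
  rw [chartVolume_apply x x.open_source.measurableSet.compl]
  have : x.target ∩ x.symm ⁻¹' x.sourceᶜ = ∅ := by
    ext u
    simp only [Set.mem_inter_iff, Set.mem_preimage, Set.mem_compl_iff, Set.mem_empty_iff_false,
      iff_false, not_and, not_not]
    exact fun hu => x.map_target hu
  rw [this]
  simp

theorem chartVolume_restrict_source (x : OpenPartialHomeomorph M (Coord d)) :
    (chartVolume x).restrict x.source = chartVolume x :=
  Measure.restrict_eq_self_of_ae_mem (chartVolume_compl_source x)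

/-- The measure of `y` only charges `y.source`, and on the overlap of the two domains both measures
agree. -/
theorem chartVolume_restrict_le {x y : OpenPartialHomeomorph M (Coord d)}
    (hx : x ∈ IsManifold.maximalAtlas (𝓡 d) ∞ M) (hy : y ∈ IsManifold.maximalAtlas (𝓡 d) ∞ M) :
    (chartVolume y).restrict x.source ≤ chartVolume x := by
  rw [Measure.le_iff]
  intro s hs
  have hms := (hs.inter x.open_source.measurableSet).inter y.open_source.measurableSet
  calc (chartVolume y).restrict x.source s
      = chartVolume y (s ∩ x.source) := Measure.restrict_apply hs
    _ = chartVolume y (s ∩ x.source ∩ y.source) := by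
        conv_lhs => rw [← chartVolume_restrict_source y,
          Measure.restrict_apply (hs.inter x.open_source.measurableSet)]
    _ = chartVolume x (s ∩ x.source ∩ y.source) :=
        chartVolume_apply_eq hx hy hms (fun _ h => h.1.2) (fun _ h => h.2)
    _ ≤ chartVolume x s := measure_mono fun _ h => h.1.1

/-- The Riemannian volume is `|g|^{1/2} dx` on the domain of a chart `x`. -/
theorem riemVolume_restrict_source {x : OpenPartialHomeomorph M (Coord d)}
    (hx : x ∈ IsManifold.maximalAtlas (𝓡 d) ∞ M) :
    (riemVolume d M).restrict x.source = chartVolume x := by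
  have hms := x.open_source.measurableSet
  have hle (y : OpenPartialHomeomorph M (Coord d))
      (hy : y ∈ IsManifold.maximalAtlas (𝓡 d) ∞ M) : chartVolume y ≤ riemVolume d M :=
    le_iSup₂ (f := fun y (_ : y ∈ IsManifold.maximalAtlas (𝓡 d) ∞ M) => chartVolume y) y hy
  apply le_antisymm
  -- Each chart measure splits into a part on `x.source`, bounded by that of `x`, and a part off
  -- `x.source`, bounded by the supremum. The bound passes to the supremum, and restriction to
  -- `x.source` removes the second summand.
  · have h : riemVolume d M ≤ chartVolume x + (riemVolume d M).restrict x.sourceᶜ := by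
      refine iSup₂_le fun y hy => ?_
      rw [← Measure.restrict_add_restrict_compl (μ := chartVolume y) hms]
      exact add_le_add (chartVolume_restrict_le hx hy)
        (Measure.restrict_mono le_rfl (hle y hy))
    refine (Measure.restrict_mono (le_refl x.source) h).trans ?_
    rw [Measure.restrict_add, Measure.restrict_restrict hms, Set.inter_compl_self,
      Measure.restrict_empty, add_zero, chartVolume_restrict_source]
  · rw [← chartVolume_restrict_source x]
    exact Measure.restrict_mono le_rfl (hle x hx)

/-- Integration in a chart. -/
theorem integral_riemVolume {x : OpenPartialHomeomorph M (Coord d)}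
    (hx : x ∈ IsManifold.maximalAtlas (𝓡 d) ∞ M) {g : M → ℝ} {h : Coord d → ℝ}
    (hg : ∀ p ∉ x.source, g p = 0) (hc : Continuous h) (hi : Integrable h)
    (hgh : ∀ u ∈ x.target, g (x.symm u) * density x u = h u) (h0 : ∀ u ∉ x.target, h u = 0) :
    Integrable g (riemVolume d M) ∧ ∫ p, g p ∂(riemVolume d M) = ∫ u, h u := by
  have hmT := x.open_target.measurableSet
  -- Regularity of `g` is recovered from `h` by dividing by the positive density.
  have hgc : ContinuousOn g x.source := by
    have h1 : ContinuousOn (fun p => h (x p) / density x (x p)) x.source :=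
      (hc.comp_continuousOn x.continuousOn).div
        ((continuousOn_density hx).comp x.continuousOn fun p hp => x.map_source hp)
        fun p hp => (density_pos hx (x.map_source hp)).ne'
    refine h1.congr fun p hp => ?_
    change g p = h (x p) / density x (x p)
    rw [← hgh _ (x.map_source hp), x.left_inv hp,
      mul_div_cancel_right₀ _ (density_pos hx (x.map_source hp)).ne']
  have hgm : AEStronglyMeasurable g (chartVolume x) := by
    rw [← chartVolume_restrict_source]
    exact hgc.aestronglyMeasurable x.open_source.measurableSet
  have hdm : AEMeasurable (fun u => ENNReal.ofReal (density x u)) (volume.restrict x.target) :=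
    ((continuousOn_density hx).aemeasurable hmT).ennreal_ofReal
  have hfin : ∀ᵐ u ∂((volume : Measure (Coord d)).restrict x.target),
      ENNReal.ofReal (density x u) < ⊤ := by simp
  have hcongr : Set.EqOn (fun u => (ENNReal.ofReal (density x u)).toReal • g (x.symm u)) h
      x.target := fun u hu => by
    simp only [smul_eq_mul]
    rw [ENNReal.toReal_ofReal (density_pos hx hu).le, mul_comm, hgh u hu]
  constructor
  · rw [← integrableOn_iff_integrable_of_support_subset (s := x.source)
      (fun p hp => by by_contra hps; exact hp (hg p hps)), IntegrableOn,
      riemVolume_restrict_source hx]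
    rw [chartVolume] at hgm ⊢
    rw [integrable_map_measure hgm (aemeasurable_symm x _),
      integrable_withDensity_iff_integrable_smul₀' hdm hfin]
    exact (integrableOn_congr_fun hcongr hmT).2 hi.integrableOn
  · rw [← setIntegral_eq_integral_of_forall_compl_eq_zero hg, riemVolume_restrict_source hx]
    rw [chartVolume] at hgm ⊢
    rw [integral_map (aemeasurable_symm x _) hgm,
      integral_withDensity_eq_integral_toReal_smul₀ hdm hfin, setIntegral_congr_fun hmT hcongr]
    exact setIntegral_eq_integral_of_forall_compl_eq_zero h0

end Volume

/-! ### The weak form: divergence theorem in a chart, then a partition of unity. -/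

section WeakForm

set_option linter.unusedSectionVars false

open MeasureTheory

variable {d : ℕ}

theorem contDiffAt_det {n : WithTop ℕ∞} {A : Coord d → Matrix (Fin d) (Fin d) ℝ} {u : Coord d}
    (hA : ∀ α i, ContDiffAt ℝ n (fun w => A w α i) u) :
    ContDiffAt ℝ n (fun w => (A w).det) u := by
  simp_rw [Matrix.det_apply]
  exact ContDiffAt.sum fun σ _ => ContDiffAt.const_smul _ (contDiffAt_prod fun i _ => hA _ _)

theorem contDiffAt_adjugate {n : WithTop ℕ∞} {A : Coord d → Matrix (Fin d) (Fin d) ℝ}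
    {u : Coord d} (hA : ∀ α i, ContDiffAt ℝ n (fun w => A w α i) u) (j γ : Fin d) :
    ContDiffAt ℝ n (fun w => (A w).adjugate j γ) u := by
  simp_rw [Matrix.adjugate_apply]
  refine contDiffAt_det fun α i => ?_
  by_cases h : α = γ
  · subst h
    simpa using contDiffAt_const
  · simpa [Matrix.updateRow_ne h] using hA α i

theorem continuous_pd {φ : Coord d → ℝ} (hφ : ContDiff ℝ 1 φ) (j : Fin d) :
    Continuous (pd j φ) :=
  (hφ.continuous_fderiv (by simp)).clm_apply continuous_const

theorem integrable_pd {φ : Coord d → ℝ} (hφ : ContDiff ℝ 1 φ) (hc : HasCompactSupport φ)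
    (j : Fin d) : Integrable (pd j φ) :=
  (continuous_pd hφ j).integrable_of_hasCompactSupport (hc.fderiv_apply ℝ (stdVec j))

/-- The integral of a partial derivative of a compactly supported function vanishes. -/
theorem integral_pd_eq_zero {φ : Coord d → ℝ} (hφ : ContDiff ℝ 1 φ) (hc : HasCompactSupport φ)
    (j : Fin d) : ∫ u, pd j φ u = 0 := by
  -- Integration by parts against the constant `1`.
  have h := integral_mul_fderiv_eq_neg_fderiv_mul_of_integrable (μ := (volume : Measure (Coord d)))
    (f := φ) (g := fun _ => (1 : ℝ)) (v := stdVec j)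
    (by simp only [mul_one]; exact integrable_pd hφ hc j) (by simp)
    (by simpa using hφ.continuous.integrable_of_hasCompactSupport hc)
    (fun z _ => hφ.differentiable (by simp) z) (fun _ _ => by simp)
  simpa [pd] using h

variable {M₁ M₂ : Type*}
  [TopologicalSpace M₁] [ChartedSpace (Coord d) M₁] [IsManifold (𝓡 d) ∞ M₁]
  [TopologicalSpace M₂] [ChartedSpace (Coord d) M₂] [IsManifold (𝓡 d) ∞ M₂]
  {f : M₁ → M₂}

/-- Keeps the pieces cut out by a partition of unity admissible; in a trivialization, scalar
multiplication acts on the fibre component. -/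
theorem IsC1Along.smul {ξ : ∀ p, TangentSpace (𝓡 d) (f p)} (hξ : IsC1Along f ξ) {φ : M₁ → ℝ}
    (hφ : ContMDiff (𝓡 d) 𝓘(ℝ, ℝ) 1 φ) : IsC1Along f (fun p => φ p • ξ p) := by
  intro p
  have h := Bundle.contMDiffAt_totalSpace.1 (hξ p)
  refine Bundle.contMDiffAt_totalSpace.2 ⟨h.1, ?_⟩
  refine ((hφ p).smul h.2).congr_of_eventuallyEq ?_
  set e := trivializationAt (Coord d) (TangentSpace (𝓡 d) : M₂ → Type _) (f p)
  have hmem : ∀ᶠ q in nhds p, f q ∈ e.baseSet :=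
    h.1.continuousAt.preimage_mem_nhds
      (e.open_baseSet.mem_nhds (mem_baseSet_trivializationAt (Coord d) _ (f p)))
  filter_upwards [hmem] with q hq
  exact (e.linear ℝ hq).2 _ _

theorem mvfderiv_finset_sum {ι : Type*} (s : Finset ι) {g : ι → M₁ → ℝ} {p : M₁}
    (hg : ∀ i, MDifferentiableAt (𝓡 d) 𝓘(ℝ, ℝ) (g i) p) :
    MDifferentiableAt (𝓡 d) 𝓘(ℝ, ℝ) (fun q => ∑ i ∈ s, g i q) p ∧
    mvfderiv (𝓡 d) (fun q => ∑ i ∈ s, g i q) p = ∑ i ∈ s, mvfderiv (𝓡 d) (g i) p := by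
  classical
  induction s using Finset.induction_on with
  | empty => simpa using ⟨mdifferentiableAt_const, mvfderiv_const (I := 𝓡 d) (0 : ℝ) (x := p)⟩
  | insert i s hi ih =>
    simp only [Finset.sum_insert hi]
    exact ⟨(hg i).add ih.1, by rw [mvfderiv_fun_add (hg i) ih.1, ih.2]⟩

variable [RiemannianBundle (fun p : M₂ => TangentSpace (𝓡 d) p)]

theorem covDeriv_finset_sum {ι : Type*} (s : Finset ι)
    {ξ : ι → ∀ p, TangentSpace (𝓡 d) (f p)} (hξ : ∀ i, IsC1Along f (ξ i)) (p : M₁) :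
    covDeriv f (fun q => ∑ i ∈ s, ξ i q) p = ∑ i ∈ s, covDeriv f (ξ i) p := by
  set y := chartAt (Coord d) (f p) with hy_def
  have hy : y ∈ IsManifold.maximalAtlas (𝓡 d) ∞ M₂ := IsManifold.chart_mem_maximalAtlas _
  have h1 (β : Fin d) : mvfderiv (𝓡 d) (fun q => comp y (f q) β (∑ i ∈ s, ξ i q)) p =
      ∑ i ∈ s, mvfderiv (𝓡 d) (fun q => comp y (f q) β (ξ i q)) p := by
    simp only [map_sum]
    refine (mvfderiv_finset_sum s fun i => ?_).2
    exact ((EuclideanSpace.proj (𝕜 := ℝ) β : Coord d →L[ℝ] ℝ).contMDiff.contMDiffAt.comp _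
        (contMDiffAt_dchart (hξ i) hy (mem_chart_source _ _))).mdifferentiableAt (by simp)
  refine LinearMap.ext fun v => ?_
  simp only [covDeriv, ← hy_def, covDerivIn, h1]
  simp only [LinearMap.sum_apply, LinearMap.smulRight_apply, LinearMap.add_apply,
    ContinuousLinearMap.coe_coe, sum_apply, LinearMap.smul_apply, map_sum]
  rw [Finset.sum_comm]
  refine Finset.sum_congr rfl fun β _ => ?_
  rw [← Finset.sum_smul, Finset.sum_add_distrib]
  congr 2
  simp only [Finset.mul_sum, Finset.sum_smul]
  rw [Finset.sum_comm_cycle]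

theorem covDeriv_eq_zero {ξ : ∀ p, TangentSpace (𝓡 d) (f p)} {p : M₁}
    (hp : p ∉ closure {p | ξ p ≠ 0}) : covDeriv f ξ p = 0 := by
  have hev : ∀ᶠ q in nhds p, ξ q = 0 := by
    filter_upwards [isClosed_closure.isOpen_compl.mem_nhds hp] with q hq
    by_contra h
    exact hq (subset_closure h)
  have h1 (y : OpenPartialHomeomorph M₂ (Coord d)) (β : Fin d) :
      mvfderiv (𝓡 d) (fun q => comp y (f q) β (ξ q)) p = 0 := by
    have h2 : (fun q => comp y (f q) β (ξ q)) =ᶠ[nhds p] fun _ => (0 : ℝ) := by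
      filter_upwards [hev] with q hq
      rw [hq, map_zero]
    ext v
    change mfderiv (𝓡 d) 𝓘(ℝ, ℝ) (fun q => comp y (f q) β (ξ q)) p v = (0 : ℝ)
    erw [h2.mfderiv_eq, mfderiv_const]
    rfl
  refine LinearMap.ext fun v => ?_
  simp [covDeriv, covDerivIn, h1, hev.self_of_nhds]

theorem homInner_zero_left {V W : Type*} [NormedAddCommGroup V] [InnerProductSpace ℝ V]
    [FiniteDimensional ℝ V] [NormedAddCommGroup W] [InnerProductSpace ℝ W] [FiniteDimensional ℝ W]
    (B : V →ₗ[ℝ] W) : homInner 0 B = 0 := by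
  simp [homInner]

theorem homInner_sum_left {V W ι : Type*} [NormedAddCommGroup V] [InnerProductSpace ℝ V]
    [FiniteDimensional ℝ V] [NormedAddCommGroup W] [InnerProductSpace ℝ W] [FiniteDimensional ℝ W]
    (s : Finset ι) (A : ι → V →ₗ[ℝ] W) (B : V →ₗ[ℝ] W) :
    homInner (∑ i ∈ s, A i) B = ∑ i ∈ s, homInner (A i) B := by
  simp only [homInner_eq_sum (stdOrthonormalBasis ℝ V), LinearMap.sum_apply, sum_inner]
  exact Finset.sum_comm

variable [IsContMDiffRiemannianBundle (𝓡 d) ∞ (Coord d) (fun p : M₂ => TangentSpace (𝓡 d) p)]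
  [RiemannianBundle (fun p : M₁ => TangentSpace (𝓡 d) p)]
  [IsContMDiffRiemannianBundle (𝓡 d) ∞ (Coord d) (fun p : M₁ => TangentSpace (𝓡 d) p)]
  {x : OpenPartialHomeomorph M₁ (Coord d)} {y : OpenPartialHomeomorph M₂ (Coord d)}

/-- The components of the vector field `(cof [df]ᵀ)^j_γ |f^*h|^{1/2} ξ^γ`, extended by zero. -/
def fluxRep (f : M₁ → M₂) (x : OpenPartialHomeomorph M₁ (Coord d))
    (y : OpenPartialHomeomorph M₂ (Coord d)) (ξ : ∀ p, TangentSpace (𝓡 d) (f p)) (j : Fin d) :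
    Coord d → ℝ :=
  (coordDomain f x y).indicator fun u =>
    ∑ γ, (jac f x y u).adjugate j γ * pullDensity f x y u * fieldRep f x y ξ u γ

theorem fluxRep_eq_zero {ξ : ∀ p, TangentSpace (𝓡 d) (f p)} {u : Coord d}
    (hu : u ∉ x '' closure {p | ξ p ≠ 0}) (j : Fin d) : fluxRep f x y ξ j u = 0 := by
  by_cases hW : u ∈ coordDomain f x y
  · have h0 : ξ (x.symm u) = 0 := by
      by_contra h
      exact hu ⟨x.symm u, subset_closure h, x.right_inv hW.1⟩
    simp [fluxRep, fieldRep, h0]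
  · simp [fluxRep, hW]

/-- Extension by zero stays `C¹`: the image of the support under `x` is compact, hence closed, and
lies in the coordinate domain, so the flux vanishes near every point outside that domain. -/
theorem contDiff_fluxRep (hf : ContMDiff (𝓡 d) (𝓡 d) 2 f)
    (hx : x ∈ IsManifold.maximalAtlas (𝓡 d) ∞ M₁) (hy : y ∈ IsManifold.maximalAtlas (𝓡 d) ∞ M₂)
    {ξ : ∀ p, TangentSpace (𝓡 d) (f p)} (hξ : IsC1Along f ξ)
    (hK : IsCompact (closure {p | ξ p ≠ 0}))
    (hsub : closure {p | ξ p ≠ 0} ⊆ x.source ∩ f ⁻¹' y.source) (j : Fin d) :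
    ContDiff ℝ 1 (fluxRep f x y ξ j) := by
  have hcl : IsClosed (x '' closure {p | ξ p ≠ 0}) :=
    (hK.image_of_continuousOn (x.continuousOn.mono fun p hp => (hsub hp).1)).isClosed
  have hW := isOpen_coordDomain hf.continuous x y
  rw [contDiff_iff_contDiffAt]
  intro u
  by_cases hu : u ∈ coordDomain f x y
  · have h : ContDiffAt ℝ 1 (fun u => ∑ γ, (jac f x y u).adjugate j γ * pullDensity f x y u *
        fieldRep f x y ξ u γ) u := by
      refine ContDiffAt.sum fun γ _ => ContDiffAt.mul (ContDiffAt.mul ?_ ?_) ?_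
      · exact contDiffAt_adjugate (contDiffAt_jacobian (contDiffAt_coordRep hf hx hy hu)) j γ
      · exact (contDiffAt_pullDensity hf hx hy hu).of_le (by norm_num)
      · exact contDiffAt_component (contDiffAt_fieldRep hξ hx hy hu) γ
    refine h.congr_of_eventuallyEq ?_
    filter_upwards [hW.mem_nhds hu] with w hw
    simp [fluxRep, hw]
  · have hu' : u ∉ x '' closure {p | ξ p ≠ 0} := by
      rintro ⟨p, hp, rfl⟩
      refine hu ⟨x.map_source (hsub hp).1, ?_⟩
      rw [x.left_inv (hsub hp).1]
      exact (hsub hp).2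
    refine (contDiffAt_const (c := (0 : ℝ))).congr_of_eventuallyEq ?_
    filter_upwards [hcl.isOpen_compl.mem_nhds hu'] with w hw
    exact fluxRep_eq_zero hw j

/-- On the coordinate domain the integrand of the weak form is a divergence. -/
theorem homInner_cofDiff_covDeriv_eq_div [NeZero d] {o₁ : ManifoldOrientation d M₁}
    {o₂ : ManifoldOrientation d M₂} (hf : ContMDiff (𝓡 d) (𝓡 d) 2 f)
    (hx : x ∈ IsManifold.maximalAtlas (𝓡 d) ∞ M₁) (hy : y ∈ IsManifold.maximalAtlas (𝓡 d) ∞ M₂)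
    (hxpos : IsPositiveChart o₁.orient x) (hypos : IsPositiveChart o₂.orient y)
    {ξ : ∀ p, TangentSpace (𝓡 d) (f p)} (hξ : IsC1Along f ξ) {u : Coord d}
    (hu : u ∈ coordDomain f x y) :
    homInner (cofDiff o₁ o₂ f (x.symm u)) (covDeriv f ξ (x.symm u)) * density x u =
      ∑ j, pd j (fluxRep f x y ξ j) u := by
  rw [homInner_cofDiff_covDeriv hf hx hy hxpos hypos hξ hu]
  have h1 (j : Fin d) : pd j (fluxRep f x y ξ j) u =
      ∑ γ, (pd j (fun w => (matCof (jac f x y w))ᵀ j γ * pullDensity f x y w) u *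
          fieldRep f x y ξ u γ + (jac f x y u).adjugate j γ * pullDensity f x y u *
          pd j (fun w => comp y (f (x.symm w)) γ (ξ (x.symm w))) u) := by
    have hev : fluxRep f x y ξ j =ᶠ[nhds u] fun u => ∑ γ, (jac f x y u).adjugate j γ *
        pullDensity f x y u * fieldRep f x y ξ u γ := by
      filter_upwards [(isOpen_coordDomain hf.continuous x y).mem_nhds hu] with w hw
      simp [fluxRep, hw]
    have ha (γ : Fin d) : DifferentiableAt ℝ
        (fun w => (jac f x y w).adjugate j γ * pullDensity f x y w) u :=
      (differentiableAt_adjugate_jac hf hx hy hu j γ).mul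
        ((contDiffAt_pullDensity hf hx hy hu).differentiableAt (by simp))
    have hb (γ : Fin d) : DifferentiableAt ℝ (fun w => fieldRep f x y ξ w γ) u :=
      (contDiffAt_component (contDiffAt_fieldRep hξ hx hy hu) γ).differentiableAt (by simp)
    have hs := HasFDerivAt.fun_sum (u := Finset.univ)
      fun γ _ => (ha γ).hasFDerivAt.fun_mul (hb γ).hasFDerivAt
    rw [pd, hev.fderiv_eq, hs.fderiv, sum_apply]
    refine Finset.sum_congr rfl fun γ _ => ?_
    simp only [add_apply, smul_apply, smul_eq_mul]
    rw [add_comm, mul_comm (fieldRep f x y ξ u γ)]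
    rfl
  simp only [h1, Finset.sum_add_distrib]
  rw [Finset.sum_comm, Finset.sum_comm (γ := Fin d) (f := fun j γ =>
    (jac f x y u).adjugate j γ * pullDensity f x y u * _), ← Finset.sum_add_distrib]
  refine Finset.sum_congr rfl fun γ _ => ?_
  -- The classical Piola identity enters here: the derivative of the coefficients is exactly the
  -- connection term of the integrand.
  have h2 := divDensityCof_eq hf hx hy hu γ
  rw [divDensityCof] at h2
  rw [← Finset.sum_mul, h2, add_mul, Finset.sum_mul, add_comm]
  congr 1
  · change _ = _ * comp y (f (x.symm u)) γ (ξ (x.symm u))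
    ring
  · refine Finset.sum_congr rfl fun j _ => ?_
    change (jac f x y u).adjugate j γ * _ * _ = _
    ring

variable [MeasurableSpace M₁] [BorelSpace M₁]

/-- The Piola identity tested with a section supported in the domain of positive charts. -/
theorem integral_homInner_covDeriv_of_subset [NeZero d] {o₁ : ManifoldOrientation d M₁}
    {o₂ : ManifoldOrientation d M₂} (hf : ContMDiff (𝓡 d) (𝓡 d) 2 f)
    (hx : x ∈ IsManifold.maximalAtlas (𝓡 d) ∞ M₁) (hy : y ∈ IsManifold.maximalAtlas (𝓡 d) ∞ M₂)
    (hxpos : IsPositiveChart o₁.orient x) (hypos : IsPositiveChart o₂.orient y)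
    {ξ : ∀ p, TangentSpace (𝓡 d) (f p)} (hξ : IsC1Along f ξ)
    (hK : IsCompact (closure {p | ξ p ≠ 0}))
    (hsub : closure {p | ξ p ≠ 0} ⊆ x.source ∩ f ⁻¹' y.source) :
    Integrable (fun p => homInner (covDeriv f ξ p) (cofDiff o₁ o₂ f p)) (riemVolume d M₁) ∧
      ∫ p, homInner (covDeriv f ξ p) (cofDiff o₁ o₂ f p) ∂(riemVolume d M₁) = 0 := by
  have hV := contDiff_fluxRep hf hx hy hξ hK hsub
  have hKc : IsCompact (x '' closure {p | ξ p ≠ 0}) :=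
    hK.image_of_continuousOn (x.continuousOn.mono fun p hp => (hsub hp).1)
  have hVc (j : Fin d) : HasCompactSupport (fluxRep f x y ξ j) :=
    HasCompactSupport.intro hKc fun u hu => fluxRep_eq_zero hu j
  have hpd0 {u : Coord d} (hu : u ∉ x '' closure {p | ξ p ≠ 0}) (j : Fin d) :
      pd j (fluxRep f x y ξ j) u = 0 := by
    have hev : fluxRep f x y ξ j =ᶠ[nhds u] fun _ => (0 : ℝ) := by
      filter_upwards [hKc.isClosed.isOpen_compl.mem_nhds hu] with w hw
      exact fluxRep_eq_zero hw j
    rw [pd, hev.fderiv_eq]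
    simp
  have hg0 (p : M₁) (hp : p ∉ closure {p | ξ p ≠ 0}) :
      homInner (covDeriv f ξ p) (cofDiff o₁ o₂ f p) = 0 := by
    rw [covDeriv_eq_zero hp, homInner_zero_left]
  have hsymm {u : Coord d} (hu : u ∈ x.target)
      (hmem : u ∈ x '' closure {p | ξ p ≠ 0} ∨ x.symm u ∈ closure {p | ξ p ≠ 0}) :
      x.symm u ∈ closure {p | ξ p ≠ 0} ∧ u ∈ x '' closure {p | ξ p ≠ 0} := by
    rcases hmem with ⟨p, hp, rfl⟩ | h
    · rw [x.left_inv (hsub hp).1]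
      exact ⟨hp, p, hp, rfl⟩
    · exact ⟨h, _, h, x.right_inv hu⟩
  have key := integral_riemVolume hx
    (g := fun p => homInner (covDeriv f ξ p) (cofDiff o₁ o₂ f p))
    (h := fun u => ∑ j, pd j (fluxRep f x y ξ j) u)
    (fun p hp => hg0 p fun h => hp (hsub h).1)
    (continuous_finsetSum _ fun j _ => continuous_pd (hV j) j)
    (integrable_finsetSum _ fun j _ => integrable_pd (hV j) (hVc j) j)
    -- On the support the integrand is a divergence; off it both sides vanish.
    (fun u hu => by
      by_cases hmem : x.symm u ∈ closure {p | ξ p ≠ 0}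
      · rw [homInner_comm]
        exact homInner_cofDiff_covDeriv_eq_div hf hx hy hxpos hypos hξ ⟨hu, (hsub hmem).2⟩
      · rw [hg0 _ hmem, zero_mul]
        exact (Finset.sum_eq_zero fun j _ =>
          hpd0 (fun h => hmem (hsymm hu (Or.inl h)).1) j).symm)
    (fun u hu => Finset.sum_eq_zero fun j _ => hpd0 (by
      rintro ⟨p, hp, rfl⟩
      exact hu (x.map_source (hsub hp).1)) j)
  refine ⟨key.1, key.2.trans ?_⟩
  rw [integral_finsetSum _ fun j _ => integrable_pd (hV j) (hVc j) j]
  exact Finset.sum_eq_zero fun j _ => integral_pd_eq_zero (hV j) (hVc j) j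

/-- The Riemannian Piola identity. -/
theorem riemannianPiolaOn_univ [T2Space M₁] [SecondCountableTopology M₁] [NeZero d]
    (o₁ : ManifoldOrientation d M₁) (o₂ : ManifoldOrientation d M₂)
    (hf : ContMDiff (𝓡 d) (𝓡 d) 2 f) : RiemannianPiolaOn o₁ o₂ f Set.univ := by
  intro σ hσ hK _
  have : LocallyCompactSpace M₁ := ChartedSpace.locallyCompactSpace (Coord d) M₁
  set K := closure {p | σ p ≠ 0} with hKdef
  -- Positive charts around each `p` and each `f p`; finitely many of the resulting domains cover
  -- the compact support.
  choose x hx hpx hxpos using o₁.exists_positive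
  choose y hy hqy hypos using o₂.exists_positive
  set U : M₁ → Set M₁ := fun p => (x p).source ∩ f ⁻¹' (y (f p)).source with hU
  have hUo (p : M₁) : IsOpen (U p) :=
    (x p).open_source.inter ((y (f p)).open_source.preimage hf.continuous)
  obtain ⟨t, ht⟩ := hK.elim_finite_subcover U hUo
    fun p _ => Set.mem_iUnion.2 ⟨p, hpx p, hqy (f p)⟩
  -- Indexed by the finite subcover, so `σ` is a finite sum of pieces supported in single domains.
  obtain ⟨ρ, hρ⟩ := SmoothPartitionOfUnity.exists_isSubordinate (𝓡 d)
    (isClosed_closure (s := {p | σ p ≠ 0}))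
    (fun i : t => U i) (fun i => hUo i) (by simpa [Set.iUnion_subtype] using ht)
  have hρσ (i : t) : IsC1Along f (fun p => ρ i p • σ p) :=
    hσ.smul ((ρ i).contMDiff.of_le (by norm_cast))
  have hsupp (i : t) : closure {p | ρ i p • σ p ≠ 0} ⊆ K ∩ tsupport (ρ i) := by
    refine Set.subset_inter (closure_mono fun p hp h => hp ?_)
      (closure_mono fun p hp h => hp ?_)
    · rw [h, smul_zero]
    · rw [h, zero_smul]
  have hsum : σ = fun p => ∑ i : t, ρ i p • σ p := by
    funext p
    by_cases hp : p ∈ K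
    · have h1 := ρ.sum_eq_one hp
      rw [finsum_eq_sum_of_fintype] at h1
      rw [← Finset.sum_smul, h1, one_smul]
    · have h0 : σ p = 0 := by
        by_contra h
        exact hp (subset_closure h)
      simp [h0]
  have hloc (i : t) := integral_homInner_covDeriv_of_subset (o₁ := o₁) (o₂ := o₂) hf (hx i)
    (hy (f i)) (hxpos i) (hypos (f i)) (hρσ i)
    (hK.of_isClosed_subset isClosed_closure ((hsupp i).trans Set.inter_subset_left))
    (((hsupp i).trans Set.inter_subset_right).trans (hρ i))
  have hcov (p : M₁) : homInner (covDeriv f σ p) (cofDiff o₁ o₂ f p) =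
      ∑ i : t, homInner (covDeriv f (fun q => ρ i q • σ q) p) (cofDiff o₁ o₂ f p) := by
    conv_lhs => rw [hsum]
    rw [covDeriv_finset_sum Finset.univ hρσ, homInner_sum_left]
  simp only [hcov, inner_zero_right, integral_zero]
  rw [integral_finsetSum _ fun i _ => (hloc i).1]
  exact (Finset.sum_eq_zero fun i _ => (hloc i).2).symm

end WeakForm

/-! ### The Euclidean counterexample. -/

section Euclidean

variable {d : ℕ}

theorem inner_tangentSpace_coord {q : Coord d} (v w : Coord d) :
    inner ℝ (show TangentSpace (𝓡 d) q from v) (show TangentSpace (𝓡 d) q from w) =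
      inner ℝ v w :=
  rfl

variable [NeZero d]

/-- The map that replaces the first coordinate `v₀` of `v` by `φ v₀`. -/
def mapFirst (φ : ℝ → ℝ) (v : Coord d) : Coord d := v + (φ (v 0) - v 0) • stdVec 0

theorem mapFirst_mapFirst {φ ψ : ℝ → ℝ} (h : Function.LeftInverse ψ φ) (v : Coord d) :
    mapFirst ψ (mapFirst φ v) = v := by
  ext α
  by_cases hα : α = 0
  · subst hα
    simp [mapFirst, stdVec_apply, h (v 0)]
  · simp [mapFirst, stdVec_apply, hα]

theorem contDiff_mapFirst {φ : ℝ → ℝ} (hφ : ContDiff ℝ ∞ φ) :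
    ContDiff ℝ ∞ (mapFirst φ : Coord d → Coord d) := by
  have h0 : ContDiff ℝ ∞ fun v : Coord d => v 0 :=
    (EuclideanSpace.proj (𝕜 := ℝ) (0 : Fin d) : Coord d →L[ℝ] ℝ).contDiff
  exact contDiff_id.add (((hφ.comp h0).sub h0).smul contDiff_const)

theorem fderiv_mapFirst_stdVec {φ : ℝ → ℝ} {φ' : ℝ} {v : Coord d} (hφ : HasDerivAt φ φ' (v 0))
    (α : Fin d) : fderiv ℝ (mapFirst φ) v (stdVec α) =
      (if α = 0 then φ' else 1) • stdVec α := by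
  have h0 : HasFDerivAt (fun v : Coord d => v 0)
      (EuclideanSpace.proj (𝕜 := ℝ) (0 : Fin d) : Coord d →L[ℝ] ℝ) v :=
    (EuclideanSpace.proj (𝕜 := ℝ) (0 : Fin d) : Coord d →L[ℝ] ℝ).hasFDerivAt
  have h := (hasFDerivAt_id v).fun_add
    (((hφ.comp_hasFDerivAt v h0).fun_sub h0).smul_const (stdVec (0 : Fin d)))
  have h' : HasFDerivAt (mapFirst φ) _ v := h
  rw [h'.fderiv]
  by_cases hα : α = 0
  · subst hα
    simp [stdVec_apply, sub_smul]
  · simp [stdVec_apply, hα, Ne.symm hα]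

variable (d) in
/-- The chart of `ℝᵈ` whose inverse is `v ↦ (sinh v₀, v₁, …)`. -/
def sinhChart : OpenPartialHomeomorph (Coord d) (Coord d) :=
  (Homeomorph.toOpenPartialHomeomorph
    { toFun := mapFirst Real.arsinh
      invFun := mapFirst Real.sinh
      left_inv := mapFirst_mapFirst Real.sinh_arsinh
      right_inv := mapFirst_mapFirst Real.arsinh_sinh
      continuous_toFun := (contDiff_mapFirst Real.contDiff_arsinh).continuous
      continuous_invFun := (contDiff_mapFirst Real.contDiff_sinh).continuous })

theorem sinhChart_mem_maximalAtlas :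
    sinhChart d ∈ IsManifold.maximalAtlas (𝓡 d) ∞ (Coord d) := by
  refine (IsManifold.mem_maximalAtlas_iff_contMDiffOn _).2 ⟨?_, ?_⟩
  · exact (contDiff_mapFirst Real.contDiff_arsinh).contMDiff.contMDiffOn
  · exact (contDiff_mapFirst Real.contDiff_sinh).contMDiff.contMDiffOn

/-- The chart is global and available in every dimension, including `1`, yet its density is not
constant. -/
theorem density_sinhChart (v : Coord d) : density (sinhChart d) v = Real.cosh (v 0) := by
  have hframe (α : Fin d) : frame (sinhChart d) ((sinhChart d).symm v) α =
      ((if α = 0 then Real.cosh (v 0) else 1) • stdVec α : Coord d) := by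
    rw [frame_symm sinhChart_mem_maximalAtlas (Set.mem_univ v)]
    refine Eq.trans ?_ (fderiv_mapFirst_stdVec (Real.hasDerivAt_sinh (v 0)) α)
    change mfderiv (𝓡 d) (𝓡 d) (mapFirst Real.sinh) v (stdVec α) = _
    rw [mfderiv_eq_fderiv]
    rfl
  have hgram : gram (sinhChart d) v =
      Matrix.diagonal fun α => (if α = 0 then Real.cosh (v 0) else 1) ^ 2 := by
    ext α β
    simp only [gram, Matrix.of_apply, hframe]
    rw [inner_tangentSpace_coord, inner_smul_left, inner_smul_right]
    by_cases h : α = β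
    · subst h
      rw [Matrix.diagonal_apply_eq]
      split_ifs <;> simp [stdVec, sq]
    · have h0 : inner ℝ (stdVec α : Coord d) (stdVec β) = 0 := by
        simp [stdVec, EuclideanSpace.inner_single_left, h]
      rw [h0, mul_zero, mul_zero, Matrix.diagonal_apply_ne _ h]
  rw [density, hgram, Matrix.det_diagonal, Finset.prod_pow, Real.sqrt_sq]
  · simp
  · exact Finset.prod_nonneg fun α _ => by split_ifs <;> positivity

theorem coordRep_id_self (v : Coord d) : coordRep id (sinhChart d) (sinhChart d) v = v :=
  (sinhChart d).right_inv (Set.mem_univ v)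

theorem divDensityCof_sinhChart (v : Coord d) :
    divDensityCof (id : Coord d → Coord d) (sinhChart d) (sinhChart d) 0 v = Real.sinh (v 0) := by
  -- With the same chart on both sides the identity has Jacobian matrix `1`, so the divergence
  -- reduces to `∂₀ cosh v₀`.
  have hjac (w : Coord d) : jac (id : Coord d → Coord d) (sinhChart d) (sinhChart d) w = 1 := by
    ext α i
    simp only [jac, Matrix.of_apply, coordRep_id_self, pd]
    erw [(EuclideanSpace.proj (𝕜 := ℝ) α : Coord d →L[ℝ] ℝ).fderiv]
    simp [stdVec_apply, Matrix.one_apply]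
  have h0 : HasFDerivAt (fun v : Coord d => v 0)
      (EuclideanSpace.proj (𝕜 := ℝ) (0 : Fin d) : Coord d →L[ℝ] ℝ) v :=
    (EuclideanSpace.proj (𝕜 := ℝ) (0 : Fin d) : Coord d →L[ℝ] ℝ).hasFDerivAt
  have hd : HasFDerivAt (fun v : Coord d => Real.cosh (v 0))
      (Real.sinh (v 0) • (EuclideanSpace.proj (𝕜 := ℝ) (0 : Fin d) : Coord d →L[ℝ] ℝ)) v := by
    have h := (Real.hasDerivAt_cosh (v 0)).comp_hasFDerivAt v h0
    exact h
  simp only [divDensityCof, matCof, hjac, pullDensity, coordRep_id_self, density_sinhChart,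
    Matrix.adjugate_one, Matrix.transpose_one]
  rw [Finset.sum_eq_single 0]
  · simp only [Matrix.one_apply_eq, one_mul, pd]
    rw [hd.fderiv]
    simp [stdVec_apply]
  · intro j _ hj
    simp [Matrix.one_apply_ne hj, pd]
  · simp

end Euclidean

end Piola

end

/-! ### Assembly of the main theorem. -/

theorem mainTheorem11 {d : ℕ} [NeZero d] {M₁ M₂ : Type*}
    [TopologicalSpace M₁] [T2Space M₁] [SecondCountableTopology M₁]
    [ChartedSpace (Coord d) M₁] [IsManifold (𝓡 d) ∞ M₁]
    [RiemannianBundle (fun p : M₁ => TangentSpace (𝓡 d) p)]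
    [IsContMDiffRiemannianBundle (𝓡 d) ∞ (Coord d) (fun p : M₁ => TangentSpace (𝓡 d) p)]
    [MeasurableSpace M₁] [BorelSpace M₁]
    [TopologicalSpace M₂] [T2Space M₂] [SecondCountableTopology M₂]
    [ChartedSpace (Coord d) M₂] [IsManifold (𝓡 d) ∞ M₂]
    [RiemannianBundle (fun p : M₂ => TangentSpace (𝓡 d) p)]
    [IsContMDiffRiemannianBundle (𝓡 d) ∞ (Coord d) (fun p : M₂ => TangentSpace (𝓡 d) p)]
    (o₁ : ManifoldOrientation d M₁) (o₂ : ManifoldOrientation d M₂)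
    (f : M₁ → M₂) (hf : ContMDiff (𝓡 d) (𝓡 d) 2 f) :
    -- statements in arbitrary local coordinates
    (∀ x ∈ IsManifold.maximalAtlas (𝓡 d) ∞ M₁, ∀ y ∈ IsManifold.maximalAtlas (𝓡 d) ∞ M₂,
      -- the Piola identity is equivalent to the coordinate identity with the connection term
      (RiemannianPiolaOn o₁ o₂ f (x.source ∩ f ⁻¹' y.source) ↔
        ∀ u ∈ coordDomain f x y, ∀ γ, coordPiola f x y γ u = 0) ∧
      -- which reduces to the metric-free identity
      (∀ u ∈ coordDomain f x y, ∀ γ, coordPiola f x y γ u = - divCof f x y γ u) ∧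
      ((∀ u ∈ coordDomain f x y, ∀ γ, coordPiola f x y γ u = 0) ↔
        ∀ u ∈ coordDomain f x y, ∀ γ, divCof f x y γ u = 0) ∧
      -- and this identity holds
      (∀ u ∈ coordDomain f x y, ∀ γ, divCof f x y γ u = 0) ∧
      -- the expression without connection term does not vanish in general
      (∀ u ∈ coordDomain f x y, ∀ γ, divDensityCof f x y γ u =
        pullDensity f x y u * (pullTraceChristoffel f x y γ u * (jac f x y u).det)) ∧
      (∀ u ∈ coordDomain f x y, ∀ γ, (divDensityCof f x y γ u = 0 ↔
        pullTraceChristoffel f x y γ u = 0 ∨ (jac f x y u).det = 0)) ∧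
      -- in positive coordinates, the integrand of the weak form of the Piola identity
      (IsPositiveChart o₁.orient x → IsPositiveChart o₂.orient y →
        ∀ ξ : ∀ p, TangentSpace (𝓡 d) (f p), IsC1Along f ξ → ∀ u ∈ coordDomain f x y,
          homInner (cofDiff o₁ o₂ f (x.symm u)) (covDeriv f ξ (x.symm u)) * density x u =
            ∑ γ, ((∑ j, (matCof (jac f x y u))ᵀ j γ *
                pd j (fun w => comp y (f (x.symm w)) γ (ξ (x.symm w))) u) +
              pullTraceChristoffel f x y γ u * (jac f x y u).det *
                comp y (f (x.symm u)) γ (ξ (x.symm u))) * pullDensity f x y u)) ∧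
    -- the Piola identity holds on all of `M₁`
    RiemannianPiolaOn o₁ o₂ f Set.univ ∧
    -- the formula without connection term fails already in Euclidean space
    (∃ x ∈ IsManifold.maximalAtlas (𝓡 d) ∞ (Coord d),
      ∃ y ∈ IsManifold.maximalAtlas (𝓡 d) ∞ (Coord d),
        ∃ u ∈ coordDomain (id : Coord d → Coord d) x y, ∃ γ,
          divDensityCof (id : Coord d → Coord d) x y γ u ≠ 0) := by
  have hpw {x : OpenPartialHomeomorph M₁ (Coord d)} {y : OpenPartialHomeomorph M₂ (Coord d)}
      (hx : x ∈ IsManifold.maximalAtlas (𝓡 d) ∞ M₁) (hy : y ∈ IsManifold.maximalAtlas (𝓡 d) ∞ M₂)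
      {u : Coord d} (hu : u ∈ coordDomain f x y) (γ : Fin d) : coordPiola f x y γ u = 0 := by
    rw [coordPiola_eq_neg_divCof hf hx hy hu, divCof_eq_zero hf hx hy hu, neg_zero]
  refine ⟨fun x hx y hy => ⟨?_, ?_, ?_, ?_, ?_, ?_, ?_⟩, riemannianPiolaOn_univ o₁ o₂ hf, ?_⟩
  -- The equivalence holds because both of its sides are true.
  · exact ⟨fun _ u hu γ => hpw hx hy hu γ, fun _ σ hσ hK _ =>
      riemannianPiolaOn_univ o₁ o₂ hf σ hσ hK (Set.subset_univ _)⟩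
  · exact fun u hu γ => coordPiola_eq_neg_divCof hf hx hy hu γ
  · refine forall₃_congr fun u hu γ => ?_
    rw [coordPiola_eq_neg_divCof hf hx hy hu, neg_eq_zero]
  · exact fun u hu γ => divCof_eq_zero hf hx hy hu γ
  · exact fun u hu γ => divDensityCof_eq hf hx hy hu γ
  · intro u hu γ
    rw [divDensityCof_eq hf hx hy hu, mul_eq_zero, mul_eq_zero,
      or_iff_right (pullDensity_pos hy hu).ne']
  · exact fun hxpos hypos ξ hξ u hu => homInner_cofDiff_covDeriv hf hx hy hxpos hypos hξ hu
  -- At the point `stdVec 0` the divergence is `sinh 1`, which is nonzero.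
  · refine ⟨sinhChart d, sinhChart_mem_maximalAtlas, sinhChart d, sinhChart_mem_maximalAtlas,
      stdVec 0, ⟨Set.mem_univ _, Set.mem_univ _⟩, 0, ?_⟩
    rw [divDensityCof_sinhChart]
    simp [stdVec_apply]
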